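/- Let $\square\subset\mathbb{R}^d$ be a convex polytope (the convex hull of finitely many points), let $S\subset\square$ be a finite set of data points, and let $\Diamond=\mathrm{conv}(S)$. For a convex polytope $K$ and a pair of dimensions $p=(d_1,d_2)$, $d_1<d_2$, let $\Pi_p(K)$ be the projection of $K$ onto these two dimensions, $L_p(K)$ the perimeter of this polygon (twice the length if it degenerates to a segment, $0$ if it is a point), $\Lambda(K)=\sum_p L_p(K)$, and $l_{\Pi_p(K)}(\theta)$ the orthogonal projection of $\Pi_p(K)$ onto the line $\mathbb{R}(\cos\theta,\sin\theta)$. A random cutting hyperplane $C=(p,\theta,\mathbf u)$ is *generated in* $K$ (where $\Lambda(K)>0$) as follows: choose $p$ with probability $L_p(K)/\Lambda(K)$, then $\theta\in(0,\pi]$ with density proportional to $|l_{\Pi_p(K)}(\theta)|$, then $\mathbf u$ uniformly on the segment $l_{\Pi_p(K)}(\theta)$; its hyperplane in $K$ is $\{x\in K: ((x_{d_1},x_{d_2})-\mathbf u)\cdot(\cos\theta,\sin\theta)=0\}$. $\mathrm{BlockCut}(K,\tau)$ is the random tree obtained by sampling a cost $c\sim\mathrm{Exp}(\Lambda(K))$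 ($c=\infty$ if $\Lambda(K)=0$); if $c\ge\tau$ it is a single leaf, and otherwise a cut $C$ is generated in $K$, the root is labelled $(c,C)$, and its two subtrees are independent copies of $\mathrm{BlockCut}(K',\tau-c)$ and $\mathrm{BlockCut}(K'',\tau-c)$, where $K',K''$ are the parts of $K$ on the two sides of the cut. $\mathrm{HullCut}(S,\tau)$ is defined in the same way, with the cost and the cut generated in $\mathrm{conv}(S)$, and with the subtrees $\mathrm{HullCut}(S',\tau-c)$ and $\mathrm{HullCut}(S'',\tau-c)$, where $S',S''$ are the data points on the two sides of the cut. The *restriction* of a tree of cuts of $\square$ to $\Diamond$ keeps a cut if its hyperplane meets $\Diamond$ (its two subtrees are then restricted to the two parts of $\Diamond$), and otherwise skips it, continuing in the sub-block that contains $\Diamond$ and adding the cost of the skipped cut to the cost of the next cut. The restriction to the data hulls of $S$ is defined in the same way, with $\mathrm{conv}(S)$ in place of $\Diamond$ and with $S',S''$ in place of the two parts of $\Diamond$. Then: 1. If $\Lambda(\Diamond)>0$, the law of a cutting hyperplane generated in $\Diamond$ is a probability measure, and it equals the law of a cutting hyperplane generated in $\square$, conditioned on meeting $\Diamond$. 2.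 For every budget $\tau\in\mathbb{R}$, the recursions $\mathrm{BlockCut}(\square,\tau)$ and $\mathrm{HullCut}(S,\tau)$ stop almost surely. The tree $\mathrm{HullCut}(S,\tau)$ (costs, hyperplanes and tree structure) has the same law as the restriction of $\mathrm{BlockCut}(\square,\tau)$ to the data hulls of $S$. 3. For every $\tau\in\mathbb{R}$, $\mathrm{BlockCut}(\Diamond,\tau)$ has the same law as the restriction of $\mathrm{BlockCut}(\square,\tau)$ to $\Diamond$. -/

import Mathlib

open MeasureTheory ProbabilityTheory

namespace BSP

/-! ### Planar geometry -/

/-- The Euclidean plane. -/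
abbrev Plane : Type := EuclideanSpace ℝ (Fin 2)

/-- `x` lies on or to the left of the oriented line through `p` and `q`. -/
def LeftOf (p q x : Plane) : Prop :=
  0 ≤ (q 0 - p 0) * (x 1 - p 1) - (q 1 - p 1) * (x 0 - p 0)

/-- `(p, q)` is a counterclockwise oriented edge of the convex polygon `Q`: two distinct vertices
such that `Q` lies to the left of the line through them.
A polygon that degenerates to a segment has the two edges `(p, q)` and `(q, p)`. -/
def IsEdge (Q : Set Plane) (e : Plane × Plane) : Prop :=
  e.1 ∈ Q.extremePoints ℝ ∧ e.2 ∈ Q.extremePoints ℝ ∧ e.1 ≠ e.2 ∧ ∀ x ∈ Q, LeftOf e.1 e.2 x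

/-- The perimeter of a convex polygon: the sum of the lengths of its edges
(a degenerate polygon, i.e. a segment, has as perimeter twice its length; a point has `0`). -/
noncomputable def perimeter (Q : Set Plane) : ENNReal :=
  ∑' e : {e : Plane × Plane // IsEdge Q e}, edist e.1.1 e.1.2

/-- The segment `l_Q(θ)` of `Q` in the direction `θ`: the orthogonal projection of `Q` onto the
line `ℝ • (cos θ, sin θ)`, written in the arc length coordinate `s` of the point
`s • (cos θ, sin θ)`. -/
def dirSegment (Q : Set Plane) (θ : ℝ) : Set ℝ :=
  (fun y : Plane => y 0 * Real.cos θ + y 1 * Real.sin θ) '' Q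

/-- The law of the angle: density on `(0, π]` proportional to `|l_Q(θ)|`. -/
noncomputable def angleLaw (Q : Set Plane) : Measure ℝ :=
  (∫⁻ θ in Set.Ioc 0 Real.pi, volume (dirSegment Q θ))⁻¹ •
    (volume.restrict (Set.Ioc 0 Real.pi)).withDensity (fun θ => volume (dirSegment Q θ))

/-- The law of the cutting position: uniform on the segment `l_Q(θ)`. -/
noncomputable def positionLaw (Q : Set Plane) (θ : ℝ) : Measure ℝ :=
  ProbabilityTheory.cond volume (dirSegment Q θ)

/-- The joint law of angle and position: sample the angle, then the position given the angle. -/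
noncomputable def lineLaw (Q : Set Plane) : Measure (ℝ × ℝ) :=
  (angleLaw Q).bind fun θ => (positionLaw Q θ).map fun s => (θ, s)

/-! ### Cutting hyperplanes in `ℝ^d` -/

/-- `ℝ^d`. -/
abbrev Space (d : ℕ) : Type := EuclideanSpace ℝ (Fin d)

/-- The set of pairs of dimensions. -/
abbrev DimPair (d : ℕ) : Type := {p : Fin d × Fin d // p.1 < p.2}

/-- The projection onto a pair of dimensions. -/
noncomputable def proj {d : ℕ} (p : DimPair d) (x : Space d) : Plane := !₂[x p.1.1, x p.1.2]

/-- The sum of the perimeters of all two-dimensional projections. -/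
noncomputable def totalPerimeter {d : ℕ} (K : Set (Space d)) : ENNReal :=
  ∑ p : DimPair d, perimeter (proj p '' K)

/-- The parameters of a cutting hyperplane: pair of dimensions, angle `θ`, and the coordinate `s`
of the cutting position `u = s • (cos θ, sin θ)`. -/
abbrev Cut (d : ℕ) : Type := DimPair d × ℝ × ℝ

/-- The angle of a cut. -/
def Cut.angle {d : ℕ} (C : Cut d) : ℝ := C.2.1

/-- The cutting position of a cut, as a point of the plane of the chosen pair of dimensions. -/
noncomputable def Cut.pos {d : ℕ} (C : Cut d) : Plane :=
  !₂[C.2.2 * Real.cos C.angle, C.2.2 * Real.sin C.angle]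

/-- The signed distance of `x` from the cutting hyperplane
(`(cos θ, sin θ)` is the normal direction `(1, tan θ)`, normalised so that `θ = π / 2` makes
sense). -/
noncomputable def Cut.offset {d : ℕ} (C : Cut d) (x : Space d) : ℝ :=
  (proj C.1 x 0 - C.pos 0) * Real.cos C.angle + (proj C.1 x 1 - C.pos 1) * Real.sin C.angle

/-- The cutting hyperplane, restricted to `K`. -/
def hyperplane {d : ℕ} (K : Set (Space d)) (C : Cut d) : Set (Space d) := {x ∈ K | C.offset x = 0}

/-- The part of `K` on the first side of the cut. -/
def leftPart {d : ℕ} (K : Set (Space d)) (C : Cut d) : Set (Space d) := {x ∈ K | C.offset x ≤ 0}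

/-- The part of `K` on the second side of the cut. -/
def rightPart {d : ℕ} (K : Set (Space d)) (C : Cut d) : Set (Space d) := {x ∈ K | 0 ≤ C.offset x}

/-- The law of the pair of dimensions: proportional to the perimeters of the projections. -/
noncomputable def pairLaw {d : ℕ} (K : Set (Space d)) : Measure (DimPair d) :=
  ∑ p : DimPair d, (perimeter (proj p '' K) / totalPerimeter K) • Measure.dirac p

/-- The law of a cutting hyperplane generated in the block `K`: sample the pair of dimensions,
then angle and position in the projection of `K` onto that pair. -/
noncomputable def cutLaw {d : ℕ} (K : Set (Space d)) : Measure (Cut d) :=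
  (pairLaw K).bind fun p => (lineLaw (proj p '' K)).map fun y => (p, y)

/-! ### Trees of cuts -/

/-- Finite binary trees whose inner nodes carry labels in `α`. -/
inductive BinTree (α : Type) : Type
  | leaf : BinTree α
  | node : α → BinTree α → BinTree α → BinTree α

/-- The label at an address of a tree (`Sum.inl ()` if there is no inner node there). -/
def BinTree.label {α : Type} : BinTree α → List Bool → Unit ⊕ α
  | .leaf, _ => Sum.inl ()
  | .node a _ _, [] => Sum.inr a
  | .node _ l r, b :: w => if b then r.label w else l.label w

/-- The σ-algebra on trees generated by the labels at all addresses. -/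
instance {α : Type} [MeasurableSpace α] : MeasurableSpace (BinTree α) :=
  MeasurableSpace.comap BinTree.label inferInstance

/-- A tree of cuts: every inner node carries the cost of its cut and the cutting hyperplane. -/
abbrev CutTree (d : ℕ) : Type := BinTree (ℝ × Cut d)

/-- The law of the output of the recursive cutting procedure on the domain `D` with budget `τ`, on
the event that the recursion has fewer than `n` levels of nested cuts.
The block that is cut in the domain `D` is `hull D`, and the two parts of `D` are treated
independently with the remaining budget. The cost is exponential with rate the total
perimeter of the block; it is infinite if this rate is `0`. -/
noncomputable def treeLawUpTo {d : ℕ} (hull : Set (Space d) → Set (Space d)) :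
    ℕ → Set (Space d) → ℝ → Measure (CutTree d)
  | 0, _, _ => 0
  | n + 1, D, τ =>
    open Classical in
    if totalPerimeter (hull D) = 0 then Measure.dirac .leaf
    else (expMeasure (totalPerimeter (hull D)).toReal).bind fun c =>
      if c < τ then
        (cutLaw (hull D)).bind fun C =>
          ((treeLawUpTo hull n (leftPart D C) (τ - c)).prod
            (treeLawUpTo hull n (rightPart D C) (τ - c))).map
              fun t => BinTree.node (c, C) t.1 t.2
      else Measure.dirac .leaf

/-- The law of the output of the recursive cutting procedure. -/
noncomputable def treeLaw {d : ℕ} (hull : Set (Space d) → Set (Space d)) (D : Set (Space d))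
    (τ : ℝ) : Measure (CutTree d) :=
  ⨆ n, treeLawUpTo hull n D τ

/-- The law of the BSP-tree on the block `K` with budget `τ`: the sub-blocks are the parts of the
block on the two sides of the cut. -/
noncomputable def blockCutLaw {d : ℕ} (K : Set (Space d)) (τ : ℝ) : Measure (CutTree d) :=
  treeLaw id K τ

/-- The law of the tree of data hulls with budget `τ`: the convex hull of the data is cut, and the
sub-blocks are the convex hulls of the data on the two sides of the cut. -/
noncomputable def hullCutLaw {d : ℕ} (S : Set (Space d)) (τ : ℝ) : Measure (CutTree d) :=
  treeLaw (fun A => convexHull ℝ A) S τ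

open Classical in
/-- Restriction of a tree of cuts to the domain `D`: a cut is kept if it meets `hull D`, and
otherwise the restriction is continued in the sub-block that contains `D`.
The argument `a` is the accumulated cost of the cuts skipped since the last cut kept. -/
noncomputable def restrictFrom {d : ℕ} (hull : Set (Space d) → Set (Space d)) :
    CutTree d → Set (Space d) → ℝ → CutTree d
  | .leaf, _, _ => .leaf
  | .node (c, C) l r, D, a =>
    if (hyperplane (hull D) C).Nonempty then
      .node (a + c, C) (restrictFrom hull l (leftPart D C) 0)
        (restrictFrom hull r (rightPart D C) 0)
    else if leftPart D C = D then restrictFrom hull l D (a + c)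
    else restrictFrom hull r D (a + c)

/-- Restriction of a BSP-tree to a convex subdomain `K`. -/
noncomputable def restrictToBlock {d : ℕ} (K : Set (Space d)) (t : CutTree d) : CutTree d :=
  restrictFrom id t K 0

/-- Restriction of a BSP-tree to the convex hulls of the data `S`. -/
noncomputable def restrictToHulls {d : ℕ} (S : Set (Space d)) (t : CutTree d) : CutTree d :=
  restrictFrom (fun A => convexHull ℝ A) t S 0

end BSP

/-!
By Cauchy's formula the perimeter of a convex polygon `Q` is the measure, under `dθ ds`, of the set
of lines that meet `Q`. Hence a cut generated in a block `K` is distributed as the invariant measure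
on all cuts, conditioned on meeting `K`; conditioning again on meeting a smaller block gives the law
generated in the smaller block. This is the first claim.

Cuts of the large block arrive at rate `Λ(□)`, and each of them meets the domain with probability
`Λ(◇) / Λ(□)`. Since the exponential law is memoryless, skipping the cuts that miss the domain
leaves a clock of rate `Λ(◇)`. By induction on the depth, the restriction of the tree of bounded
depth is at most the law of the tree generated in the domain. Both full laws are probability
measures, because `Λ` does not increase along cuts, so that the probability of `n` nested cuts
within the budget `τ` is at most `2⁻ⁿ exp (4 Λ(□) τ)`. A measure below a probability measure with
the same mass is equal to it.

On convex domains the convex hull is the identity, so `BlockCut` is an instance of `HullCut`.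
-/

namespace BSP

/-! ### Polytopes -/

section Polytope

variable {E E' : Type*} [AddCommGroup E] [Module ℝ E] [AddCommGroup E'] [Module ℝ E']

/-- A convex polytope: the convex hull of finitely many points. -/
def IsPolytope (K : Set E) : Prop := ∃ V : Finset E, K = convexHull ℝ (V : Set E)

lemma isPolytope_convexHull_of_finite {s : Set E} (hs : s.Finite) :
    IsPolytope (convexHull ℝ s) :=
  ⟨hs.toFinset, by rw [hs.coe_toFinset]⟩

namespace IsPolytope

variable {K : Set E}

lemma convex (hK : IsPolytope K) : Convex ℝ K := by
  obtain ⟨V, rfl⟩ := hK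
  exact convex_convexHull ℝ _

lemma linear_image (hK : IsPolytope K) (f : E →ₗ[ℝ] E') : IsPolytope (f '' K) := by
  classical
  obtain ⟨V, rfl⟩ := hK
  exact ⟨V.image f, by rw [f.image_convexHull, Finset.coe_image]⟩

lemma finite_extremePoints (hK : IsPolytope K) : (K.extremePoints ℝ).Finite := by
  obtain ⟨V, rfl⟩ := hK
  exact V.finite_toSet.subset extremePoints_convexHull_subset

variable [TopologicalSpace E] [IsTopologicalAddGroup E] [ContinuousSMul ℝ E]

lemma isCompact (hK : IsPolytope K) : IsCompact K := by
  obtain ⟨V, rfl⟩ := hK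
  exact V.finite_toSet.isCompact_convexHull ℝ

variable [T2Space E] [LocallyConvexSpace ℝ E]

lemma convexHull_extremePoints (hK : IsPolytope K) : convexHull ℝ (K.extremePoints ℝ) = K := by
  rw [← (hK.finite_extremePoints.isClosed_convexHull ℝ).closure_eq]
  exact closure_convexHull_extremePoints hK.isCompact hK.convex

end IsPolytope

/-- The point of the line through `u` and `v` at which the affine function `g` vanishes. -/
noncomputable def zeroPoint (g : E →ᵃ[ℝ] ℝ) (u v : E) : E :=
  AffineMap.lineMap u v (g u / (g u - g v))

lemma apply_zeroPoint (g : E →ᵃ[ℝ] ℝ) {u v : E} (h : g u ≠ g v) : g (zeroPoint g u v) = 0 := by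
  rw [zeroPoint, AffineMap.apply_lineMap, AffineMap.lineMap_apply_ring']
  field_simp [sub_ne_zero.2 h]
  ring

lemma zeroPoint_mem_segment (g : E →ᵃ[ℝ] ℝ) {u v : E} (hu : g u ≤ 0) (hv : 0 < g v) :
    zeroPoint g u v ∈ segment ℝ u v := by
  rw [segment_eq_image_lineMap]
  refine Set.mem_image_of_mem _ ⟨div_nonneg_of_nonpos hu (by linarith), ?_⟩
  rw [div_le_one_of_neg (by linarith)]
  linarith

/-- Linear duality in the plane: points `(f, ψ)` whose pairwise determinants have the right sign lie
below a line of slope `l ≥ 0` through the origin. -/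
lemma exists_nonneg_forall_le_mul {ι : Type*} {N P : Set ι} (hP : P.Finite) {f ψ : ι → ℝ}
    (hfP : ∀ p ∈ P, 0 < f p) (hψN : ∀ n ∈ N, ψ n ≤ 0)
    (hdet : ∀ n ∈ N, ∀ p ∈ P, ψ n * f p ≤ ψ p * f n) :
    ∃ l : ℝ, 0 ≤ l ∧ ∀ v ∈ N ∪ P, ψ v ≤ l * f v := by
  by_cases hle : ∀ p ∈ P, ψ p ≤ 0
  · exact ⟨0, le_rfl, fun v hv => by simpa using hv.elim (hψN v) (hle v)⟩
  push Not at hle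
  obtain ⟨q, hq, hψq⟩ := hle
  obtain ⟨p, hp, hmax⟩ := Set.exists_max_image P (fun p => ψ p / f p) hP ⟨q, hq⟩
  refine ⟨ψ p / f p, (div_pos hψq (hfP q hq)).le.trans (hmax q hq), ?_⟩
  rintro v (hv | hv)
  · rw [div_mul_eq_mul_div, le_div_iff₀ (hfP p hp)]
    exact hdet v hv p hp
  · exact (div_le_iff₀ (hfP v hv)).1 (hmax v hv)

variable [TopologicalSpace E] [IsTopologicalAddGroup E] [ContinuousSMul ℝ E] [T2Space E]
  [LocallyConvexSpace ℝ E]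

/-- If `x` were outside the hull on the right, some `φ` would separate it from this hull, say
`φ < c` there and `c < φ x`; then some `l ≥ 0` satisfies `φ - c ≤ l * g` on `V`, hence at `x`, where
`g x ≤ 0`. -/
lemma convexHull_inter_halfSpace_subset {V : Set E} (hV : V.Finite) (g : E →ᵃ[ℝ] ℝ) :
    {x ∈ convexHull ℝ V | g x ≤ 0} ⊆ convexHull ℝ ({v ∈ V | g v ≤ 0} ∪
      Set.image2 (zeroPoint g) {v ∈ V | g v ≤ 0} {v ∈ V | 0 < g v}) := by
  set N := {v ∈ V | g v ≤ 0}
  set P := {v ∈ V | 0 < g v}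
  have hP : P.Finite := hV.subset (Set.sep_subset _ _)
  have hN : N.Finite := hV.subset (Set.sep_subset _ _)
  have hW : (N ∪ Set.image2 (zeroPoint g) N P).Finite := hN.union (hN.image2 _ hP)
  rintro x ⟨hxV, hgx⟩
  by_contra hx
  obtain ⟨φ, c, hφ, hcx⟩ := geometric_hahn_banach_closed_point (convex_convexHull ℝ _)
    (hW.isClosed_convexHull ℝ) hx
  have hφN : ∀ n ∈ N, φ n - c ≤ 0 := fun n hn =>
    (sub_neg.2 (hφ n (subset_convexHull ℝ _ (Or.inl hn)))).le
  have hφNP : ∀ n ∈ N, ∀ p ∈ P, (φ n - c) * g p ≤ (φ p - c) * g n := fun n hn p hp => by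
    have hd : 0 < g p - g n := sub_pos.2 (hn.2.trans_lt hp.2)
    have h := hφ _ (subset_convexHull ℝ _ (Or.inr (Set.mem_image2_of_mem hn hp)))
    have h' := mul_lt_mul_of_pos_right h hd
    have e : φ (zeroPoint g n p) * (g p - g n) = φ n * g p - φ p * g n := by
      rw [zeroPoint, AffineMap.lineMap_apply_module', map_add, map_smul, map_sub, smul_eq_mul,
        ← neg_div_neg_eq, neg_sub]
      field_simp
      ring
    linarith
  obtain ⟨l, hl, hle⟩ := exists_nonneg_forall_le_mul hP (fun p hp => hp.2) hφN hφNP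
  have hconv : Convex ℝ {y | φ y - c ≤ l * g y} := by
    have heq : {y | φ y - c ≤ l * g y} =
        (φ.toLinearMap.toAffineMap - l • g) ⁻¹' Set.Iic c :=
      Set.ext fun y => sub_le_comm (a := φ y)
    rw [heq]
    exact (convex_Iic c).affine_preimage _
  have hVle : V ⊆ {y | φ y - c ≤ l * g y} := fun v hv =>
    hle v ((le_or_gt (g v) 0).imp (⟨hv, ·⟩) (⟨hv, ·⟩))
  have hxle : φ x - c ≤ l * g x := convexHull_min hVle hconv hxV
  linarith [mul_nonpos_of_nonneg_of_nonpos hl hgx]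

lemma IsPolytope.inter_halfSpace {K : Set E} (hK : IsPolytope K) (g : E →ᵃ[ℝ] ℝ) :
    IsPolytope {x ∈ K | g x ≤ 0} := by
  obtain ⟨V, rfl⟩ := hK
  have hfin : ∀ p : E → Prop, {v ∈ (V : Set E) | p v}.Finite := fun p =>
    V.finite_toSet.subset (Set.sep_subset _ _)
  have heq : {x ∈ convexHull ℝ (V : Set E) | g x ≤ 0} = convexHull ℝ ({v ∈ (V : Set E) | g v ≤ 0} ∪
      Set.image2 (zeroPoint g) {v ∈ (V : Set E) | g v ≤ 0} {v ∈ (V : Set E) | 0 < g v}) := by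
    refine (convexHull_inter_halfSpace_subset V.finite_toSet g).antisymm (convexHull_min ?_ ?_)
    · rintro x (hx | ⟨u, hu, v, hv, rfl⟩)
      · exact ⟨subset_convexHull ℝ _ hx.1, hx.2⟩
      · exact ⟨segment_subset_convexHull hu.1 hv.1 (zeroPoint_mem_segment g hu.2 hv.2),
          (apply_zeroPoint g (hu.2.trans_lt hv.2).ne).le⟩
    · exact (convex_convexHull ℝ _).inter ((convex_Iic (0 : ℝ)).affine_preimage g)
  rw [heq]
  exact isPolytope_convexHull_of_finite ((hfin _).union ((hfin _).image2 _ (hfin _)))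

end Polytope

/-! ### Cauchy's formula for polygons -/

open scoped Real

/-- The height of a point in the direction `(cos θ, sin θ)`. -/
noncomputable def height (θ : ℝ) : Plane →L[ℝ] ℝ :=
  (EuclideanSpace.proj 0).smulRight (Real.cos θ) + (EuclideanSpace.proj 1).smulRight (Real.sin θ)

lemma height_apply (θ : ℝ) (y : Plane) : height θ y = y 0 * Real.cos θ + y 1 * Real.sin θ := rfl

lemma dirSegment_eq_image_height (Q : Set Plane) (θ : ℝ) : dirSegment Q θ = height θ '' Q := rfl

lemma height_add_pi (θ : ℝ) (y : Plane) : height (θ + π) y = -height θ y := by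
  rw [height_apply, height_apply, Real.cos_add_pi, Real.sin_add_pi]
  ring

/-- Twice the signed area of the triangle `p q x`. -/
def orient (p q x : Plane) : ℝ := (q 0 - p 0) * (x 1 - p 1) - (q 1 - p 1) * (x 0 - p 0)

lemma leftOf_iff_orient_nonneg {p q x : Plane} : LeftOf p q x ↔ 0 ≤ orient p q x := Iff.rfl

lemma orient_swap (p q x : Plane) : orient q p x = -orient p q x := by
  unfold orient
  ring

lemma convex_leftOf (p q : Plane) : Convex ℝ {x | LeftOf p q x} := by
  intro x hx y hy s t hs ht hst
  have hcomb : orient p q (s • x + t • y) = s * orient p q x + t * orient p q y := by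
    simp only [orient, PiLp.add_apply, PiLp.smul_apply, smul_eq_mul]
    linear_combination ((q 0 - p 0) * p 1 - (q 1 - p 1) * p 0) * hst
  exact (add_nonneg (mul_nonneg hs hx) (mul_nonneg ht hy)).trans_eq hcomb.symm

lemma sub_smul_of_orient_eq_zero {p q x : Plane} (h : orient p q x = 0) (θ : ℝ) :
    (height θ q - height θ p) • (x - p) = (height θ x - height θ p) • (q - p) := by
  unfold orient at h
  ext i
  fin_cases i <;>
    simp only [height_apply, PiLp.smul_apply, PiLp.sub_apply, smul_eq_mul, Fin.zero_eta,
      Fin.mk_one]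
  · linear_combination -Real.sin θ * h
  · linear_combination Real.cos θ * h

/-- The determinant is invariant under the rotation by `θ`. -/
lemma orient_eq_height (θ : ℝ) (p q x : Plane) :
    orient p q x = (height θ q - height θ p) * (height (θ + π / 2) x - height (θ + π / 2) p) -
      (height (θ + π / 2) q - height (θ + π / 2) p) * (height θ x - height θ p) := by
  simp only [orient, height_apply, Real.cos_add_pi_div_two, Real.sin_add_pi_div_two]
  linear_combination -((q 0 - p 0) * (x 1 - p 1) - (q 1 - p 1) * (x 0 - p 0)) *
    Real.cos_sq_add_sin_sq θ

section Crossing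

variable {Q : Set Plane} {θ s : ℝ}

lemma eq_of_extreme_of_orient_eq_zero {p p' q : Plane} (hp : p ∈ Q.extremePoints ℝ)
    (hp' : p' ∈ Q.extremePoints ℝ) (hq : q ∈ Q) (hpq : height θ p < height θ q)
    (hpq' : height θ p' < height θ q) (h : orient p q p' = 0) : p = p' := by
  wlog hle : height θ p ≤ height θ p' generalizing p p'
  · refine (this hp' hp hpq' hpq ?_ (not_le.1 hle).le).symm
    unfold orient at h ⊢
    linear_combination -h
  have hd : 0 < height θ q - height θ p := sub_pos.2 hpq
  set t := (height θ p' - height θ p) / (height θ q - height θ p) with ht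
  have hp't : p' = AffineMap.lineMap p q t := by
    rw [AffineMap.lineMap_apply_module', ht, div_eq_inv_mul, mul_smul,
      ← sub_smul_of_orient_eq_zero h, inv_smul_smul₀ hd.ne', sub_add_cancel]
  rcases hle.eq_or_lt with heq | hlt
  · rw [hp't, ht, heq, sub_self, zero_div, AffineMap.lineMap_apply_zero]
  · refine hp'.2 hp.1 hq ?_
    rw [openSegment_eq_image_lineMap]
    exact ⟨t, ⟨div_pos (sub_pos.2 hlt) hd, (div_lt_one hd).2 (by linarith)⟩, hp't.symm⟩

/-- Each of two edges that cross the line at height `s` lies to the left of the other one, so both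
cross the line in the same point and are collinear. -/
lemma IsEdge.eq_of_crossing {e f : Plane × Plane} (he : IsEdge Q e) (hf : IsEdge Q f)
    (hes : s ∈ Set.Ioo (height θ e.1) (height θ e.2))
    (hfs : s ∈ Set.Ioo (height θ f.1) (height θ f.2)) : e = f := by
  obtain ⟨p, q⟩ := e
  obtain ⟨p', q'⟩ := f
  obtain ⟨hp, hq, -, hleft⟩ := he
  obtain ⟨hp', hq', -, hleft'⟩ := hf
  obtain ⟨hps, hsq⟩ := hes
  obtain ⟨hps', hsq'⟩ := hfs
  dsimp only at *
  have hsum : ((height θ q' - s) * orient p q p' + (s - height θ p') * orient p q q') +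
      ((height θ q - s) * orient p' q' p + (s - height θ p) * orient p' q' q) = 0 := by
    simp only [orient, height_apply]
    ring
  have h₁ : 0 ≤ (height θ q' - s) * orient p q p' :=
    mul_nonneg (sub_nonneg.2 hsq'.le) (hleft p' hp'.1)
  have h₂ : 0 ≤ (s - height θ p') * orient p q q' :=
    mul_nonneg (sub_nonneg.2 hps'.le) (hleft q' hq'.1)
  have h₃ : 0 ≤ (height θ q - s) * orient p' q' p :=
    mul_nonneg (sub_nonneg.2 hsq.le) (hleft' p hp.1)
  have h₄ : 0 ≤ (s - height θ p) * orient p' q' q :=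
    mul_nonneg (sub_nonneg.2 hps.le) (hleft' q hq.1)
  have hcol : orient p q p' = 0 :=
    (mul_eq_zero_iff_left (sub_pos.2 hsq').ne').1 (by linarith)
  have hcol' : orient p q q' = 0 :=
    (mul_eq_zero_iff_left (sub_pos.2 hps').ne').1 (by linarith)
  have hpp' : p = p' :=
    eq_of_extreme_of_orient_eq_zero hp hp' hq.1 (hps.trans hsq) (hps'.trans hsq) hcol
  have hqq' : q = q' := by
    refine eq_of_extreme_of_orient_eq_zero (θ := θ + π) hq hq' hp.1 ?_ ?_
      (by rw [orient_swap, hcol', neg_zero]) <;>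
      rw [height_add_pi, height_add_pi, neg_lt_neg_iff]
    · exact hps.trans hsq
    · exact hps.trans hsq'
  rw [hpp', hqq']

lemma exists_extremePoint_height_lt (hQ : IsPolytope Q)
    (hsv : s ∉ height θ '' Q.extremePoints ℝ) (hsQ : s ∈ height θ '' Q) :
    ∃ v ∈ Q.extremePoints ℝ, height θ v < s := by
  obtain ⟨y, hy, rfl⟩ := hsQ
  by_contra! hle
  have hgt : Q.extremePoints ℝ ⊆ {w | height θ y < height θ w} := fun v hv =>
    (hle v hv).lt_of_ne fun h => hsv ⟨v, hv, h.symm⟩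
  have hQgt := convexHull_min hgt (convex_halfSpace_gt (height θ).isLinear _)
  rw [hQ.convexHull_extremePoints] at hQgt
  exact lt_irrefl _ (Set.mem_ofPred.1 (hQgt hy))

lemma exists_extremePoint_lt_height (hQ : IsPolytope Q)
    (hsv : s ∉ height θ '' Q.extremePoints ℝ) (hsQ : s ∈ height θ '' Q) :
    ∃ v ∈ Q.extremePoints ℝ, s < height θ v := by
  have hneg : ∀ A : Set Plane, -s ∈ height (θ + π) '' A ↔ s ∈ height θ '' A := fun A => by
    simp only [Set.mem_image, height_add_pi, neg_inj]
  obtain ⟨v, hv, h⟩ := exists_extremePoint_height_lt (θ := θ + π) hQ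
    ((hneg _).not.2 hsv) ((hneg _).2 hsQ)
  exact ⟨v, hv, by simpa only [height_add_pi, neg_lt_neg_iff] using h⟩

/-- Among the segments from a vertex below the line at height `s` to a vertex above it, the one that
crosses this line farthest in direction `θ - π / 2` is an edge. -/
lemma exists_isEdge_crossing (hQ : IsPolytope Q)
    (hsv : s ∉ height θ '' Q.extremePoints ℝ) (hsQ : s ∈ height θ '' Q) :
    ∃ e, IsEdge Q e ∧ s ∈ Set.Ioo (height θ e.1) (height θ e.2) := by
  set E := Q.extremePoints ℝ
  set h := height θ
  set k := height (θ + π / 2)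
  have hfin : ∀ P : Plane → Prop, {v ∈ E | P v}.Finite := fun P =>
    hQ.finite_extremePoints.subset (Set.sep_subset _ _)
  obtain ⟨⟨p, q⟩, ⟨⟨hpE, hp⟩, hqE, hq⟩, hmin⟩ := Set.exists_min_image
    ({v ∈ E | h v < s} ×ˢ {v ∈ E | s < h v})
    (fun e => (k e.1 * (h e.2 - s) + k e.2 * (s - h e.1)) / (h e.2 - h e.1))
    ((hfin _).prod (hfin _))
    (Set.Nonempty.prod (exists_extremePoint_height_lt hQ hsv hsQ)
      (exists_extremePoint_lt_height hQ hsv hsQ))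
  dsimp only at hp hq hpE hqE hmin
  have hleft : E ⊆ {x | LeftOf p q x} := fun v hv => by
    rw [Set.mem_ofPred_eq, leftOf_iff_orient_nonneg, orient_eq_height θ]
    rcases lt_trichotomy (h v) s with hvs | hvs | hvs
    · have hle := hmin (v, q) ⟨⟨hv, hvs⟩, hqE, hq⟩
      dsimp only at hle
      rw [div_le_div_iff₀ (by linarith) (by linarith)] at hle
      refine (mul_nonneg_iff_of_pos_left (sub_pos.2 hq)).1 ?_
      linarith
    · exact absurd ⟨v, hv, hvs⟩ hsv
    · have hle := hmin (p, v) ⟨⟨hpE, hp⟩, hv, hvs⟩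
      dsimp only at hle
      rw [div_le_div_iff₀ (by linarith) (by linarith)] at hle
      refine (mul_nonneg_iff_of_pos_left (sub_pos.2 hp)).1 ?_
      linarith
  have hQleft := convexHull_min hleft (convex_leftOf p q)
  rw [hQ.convexHull_extremePoints] at hQleft
  exact ⟨(p, q), ⟨hpE, hqE, fun hpq => (hp.trans hq).ne (congrArg h hpq), fun x hx => hQleft hx⟩,
    hp, hq⟩

lemma tsum_indicator_Ioo_height (hQ : IsPolytope Q) (hsv : s ∉ height θ '' Q.extremePoints ℝ) :
    ∑' e : {e : Plane × Plane // IsEdge Q e},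
      (Set.Ioo (height θ e.1.1) (height θ e.1.2)).indicator (1 : ℝ → ENNReal) s =
      (height θ '' Q).indicator 1 s := by
  by_cases hsQ : s ∈ height θ '' Q
  · obtain ⟨e, he, hse⟩ := exists_isEdge_crossing hQ hsv hsQ
    rw [tsum_eq_single ⟨e, he⟩, Set.indicator_of_mem hse, Set.indicator_of_mem hsQ]
    rintro ⟨f, hf⟩ hne
    exact Set.indicator_of_notMem
      (fun hsf => hne (Subtype.ext (hf.eq_of_crossing he hsf hse))) _
  · rw [Set.indicator_of_notMem hsQ, ENNReal.tsum_eq_zero]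
    rintro ⟨f, hf⟩
    refine Set.indicator_of_notMem (fun hsf => hsQ ?_) _
    exact (hQ.convex.linear_image (height θ).toLinearMap).ordConnected.out
      ⟨_, hf.1.1, rfl⟩ ⟨_, hf.2.1.1, rfl⟩ ⟨hsf.1.le, hsf.2.le⟩

end Crossing

section Cauchy

variable {Q : Set Plane}

lemma IsPolytope.finite_isEdge (hQ : IsPolytope Q) : Finite {e // IsEdge Q e} :=
  ((hQ.finite_extremePoints.prod hQ.finite_extremePoints).subset
    fun _ he => ⟨he.1, he.2.1⟩ : {e | IsEdge Q e}.Finite)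

lemma tsum_ofReal_height_sub (hQ : IsPolytope Q) (θ : ℝ) :
    ∑' e : {e : Plane × Plane // IsEdge Q e}, ENNReal.ofReal (height θ e.1.2 - height θ e.1.1) =
      volume (dirSegment Q θ) := by
  have := hQ.finite_isEdge
  have hae : ∀ᵐ s : ℝ, s ∉ height θ '' Q.extremePoints ℝ :=
    measure_eq_zero_iff_ae_notMem.1 ((hQ.finite_extremePoints.image _).measure_zero _)
  calc ∑' e : {e : Plane × Plane // IsEdge Q e},
        ENNReal.ofReal (height θ e.1.2 - height θ e.1.1)
      = ∑' e : {e : Plane × Plane // IsEdge Q e},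
        ∫⁻ s, (Set.Ioo (height θ e.1.1) (height θ e.1.2)).indicator 1 s := by
        simp only [lintegral_indicator_one measurableSet_Ioo, Real.volume_Ioo]
    _ = ∫⁻ s, ∑' e : {e : Plane × Plane // IsEdge Q e},
        (Set.Ioo (height θ e.1.1) (height θ e.1.2)).indicator 1 s :=
        (lintegral_tsum fun e => (measurable_one.indicator measurableSet_Ioo).aemeasurable).symm
    _ = ∫⁻ s, (height θ '' Q).indicator 1 s :=
        lintegral_congr_ae (hae.mono fun s hs => tsum_indicator_Ioo_height hQ hs)
    _ = volume (dirSegment Q θ) :=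
        lintegral_indicator_one (hQ.isCompact.image (height θ).continuous).measurableSet

lemma volume_dirSegment_add_pi (Q : Set Plane) (θ : ℝ) :
    volume (dirSegment Q (θ + π)) = volume (dirSegment Q θ) := by
  have hneg : dirSegment Q (θ + π) = -dirSegment Q θ := by
    rw [← Set.image_neg_eq_neg, dirSegment_eq_image_height, dirSegment_eq_image_height,
      Set.image_image]
    exact Set.image_congr fun y _ => height_add_pi θ y
  rw [hneg, Measure.measure_neg]

lemma ofReal_add_ofReal_neg (x : ℝ) : ENNReal.ofReal x + ENNReal.ofReal (-x) = ‖x‖ₑ := by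
  rw [Real.enorm_eq_ofReal_abs]
  rcases le_total 0 x with h | h
  · rw [ENNReal.ofReal_of_nonpos (neg_nonpos.2 h), add_zero, abs_of_nonneg h]
  · rw [ENNReal.ofReal_of_nonpos h, zero_add, abs_of_nonpos h]

lemma tsum_enorm_height_sub (hQ : IsPolytope Q) (θ : ℝ) :
    ∑' e : {e : Plane × Plane // IsEdge Q e}, ‖height θ (e.1.2 - e.1.1)‖ₑ =
      2 * volume (dirSegment Q θ) := by
  rw [two_mul]
  nth_rw 2 [← volume_dirSegment_add_pi]
  rw [← tsum_ofReal_height_sub hQ, ← tsum_ofReal_height_sub hQ, ← ENNReal.tsum_add]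
  refine tsum_congr fun e => ?_
  rw [height_add_pi, height_add_pi, ← neg_sub', ofReal_add_ofReal_neg, map_sub]

lemma integral_abs_cos_sub (φ : ℝ) : ∫ θ in (0 : ℝ)..π, |Real.cos (θ - φ)| = 2 := by
  have hper : Function.Periodic (fun θ => |Real.cos θ|) π := fun θ => by
    simp only [Real.cos_add_pi, abs_neg]
  calc ∫ θ in (0 : ℝ)..π, |Real.cos (θ - φ)|
      = ∫ θ in (0 - φ)..(0 - φ + π), |Real.cos θ| := by
        rw [intervalIntegral.integral_comp_sub_right (fun θ => |Real.cos θ|),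
          sub_add_eq_add_sub, zero_add]
    _ = ∫ θ in (-(π / 2))..(-(π / 2) + π), |Real.cos θ| :=
        hper.intervalIntegral_add_eq _ _
    _ = ∫ θ in (-(π / 2))..(π / 2), Real.cos θ := by
        rw [show -(π / 2) + π = π / 2 by ring]
        refine intervalIntegral.integral_congr fun θ hθ => ?_
        rw [Set.uIcc_of_le (by linarith [Real.pi_pos])] at hθ
        exact abs_of_nonneg (Real.cos_nonneg_of_mem_Icc hθ)
    _ = 2 := by
        rw [integral_cos, Real.sin_neg, Real.sin_pi_div_two]
        norm_num

lemma exists_height_eq_norm_mul_cos (z : Plane) :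
    ∃ φ : ℝ, ∀ θ, height θ z = ‖z‖ * Real.cos (θ - φ) := by
  set w : ℂ := ⟨z 0, z 1⟩
  have hw : ‖w‖ = ‖z‖ := by
    rw [EuclideanSpace.norm_eq, Complex.norm_def, Complex.normSq_apply, Fin.sum_univ_two]
    simp only [w, Real.norm_eq_abs, sq_abs, ← sq]
  have hre : ‖w‖ * Real.cos w.arg = z 0 := Complex.norm_mul_cos_arg w
  have him : ‖w‖ * Real.sin w.arg = z 1 := Complex.norm_mul_sin_arg w
  refine ⟨w.arg, fun θ => ?_⟩
  rw [← hw, height_apply, Real.cos_sub]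
  linear_combination -Real.cos θ * hre - Real.sin θ * him

lemma lintegral_enorm_height (z : Plane) :
    ∫⁻ θ in Set.Ioc 0 π, ‖height θ z‖ₑ = 2 * ‖z‖ₑ := by
  obtain ⟨φ, hφ⟩ := exists_height_eq_norm_mul_cos z
  have hint : IntegrableOn (fun θ => |Real.cos (θ - φ)|) (Set.Ioc 0 π) :=
    (by fun_prop : Continuous fun θ => |Real.cos (θ - φ)|).integrableOn_Ioc
  simp_rw [hφ, enorm_mul, enorm_norm]
  rw [lintegral_const_mul' _ _ enorm_ne_top, mul_comm]
  simp_rw [Real.enorm_eq_ofReal_abs]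
  rw [← ofReal_integral_eq_lintegral_ofReal hint (ae_of_all _ fun θ => abs_nonneg _),
    ← intervalIntegral.integral_of_le Real.pi_pos.le, integral_abs_cos_sub, ENNReal.ofReal_ofNat]

/-- **Cauchy's formula**. -/
theorem perimeter_eq_lintegral (hQ : IsPolytope Q) :
    perimeter Q = ∫⁻ θ in Set.Ioc 0 π, volume (dirSegment Q θ) := by
  have := hQ.finite_isEdge
  have hmeas : ∀ z : Plane, Measurable fun θ => ‖height θ z‖ₑ := fun z => by
    simp only [height_apply]
    fun_prop
  have htwo : 2 * ∫⁻ θ in Set.Ioc 0 π, volume (dirSegment Q θ) = 2 * perimeter Q := by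
    rw [← lintegral_const_mul' _ _ ENNReal.ofNat_ne_top]
    simp_rw [← tsum_enorm_height_sub hQ]
    rw [lintegral_tsum fun e => (hmeas _).aemeasurable, perimeter, ← ENNReal.tsum_mul_left]
    refine tsum_congr fun e => ?_
    rw [lintegral_enorm_height, edist_comm, edist_eq_enorm_sub]
  exact ((ENNReal.mul_right_inj two_ne_zero ENNReal.ofNat_ne_top).1 htwo).symm

lemma perimeter_ne_top (hQ : IsPolytope Q) : perimeter Q ≠ ⊤ := by
  have := hQ.finite_isEdge
  have := Fintype.ofFinite {e // IsEdge Q e}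
  rw [perimeter, tsum_fintype]
  exact ENNReal.sum_ne_top.2 fun e _ => edist_ne_top _ _

end Cauchy

/-! ### Cuts -/

variable {d : ℕ}

/-- The projection onto a pair of dimensions, as a linear map. -/
noncomputable def projₗ (p : DimPair d) : Space d →ₗ[ℝ] Plane where
  toFun := proj p
  map_add' x y := by ext i; fin_cases i <;> rfl
  map_smul' c x := by ext i; fin_cases i <;> rfl

lemma offset_eq_height (C : Cut d) (x : Space d) :
    C.offset x = height C.angle (proj C.1 x) - C.2.2 := by
  simp only [Cut.offset, Cut.pos, height_apply, Matrix.cons_val_zero, Matrix.cons_val_one]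
  linear_combination -C.2.2 * Real.cos_sq_add_sin_sq C.angle

/-- The signed distance from the cutting hyperplane, as an affine map. -/
noncomputable def Cut.offsetₐ (C : Cut d) : Space d →ᵃ[ℝ] ℝ :=
  ((height C.angle).toLinearMap ∘ₗ projₗ C.1).toAffineMap - AffineMap.const ℝ _ C.2.2

lemma offsetₐ_apply (C : Cut d) (x : Space d) : C.offsetₐ x = C.offset x :=
  (offset_eq_height C x).symm

lemma continuous_offset : Continuous fun z : Cut d × Space d => z.1.offset z.2 := by
  have hproj : Continuous fun z : DimPair d × Space d => proj z.1 z.2 :=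
    continuous_prod_of_discrete_left.2 fun p => (projₗ p).continuous_of_finiteDimensional
  have hprojC : Continuous fun z : Cut d × Space d => proj z.1.1 z.2 :=
    hproj.comp (f := fun z : Cut d × Space d => (z.1.1, z.2)) (by fun_prop)
  have hcoord (i : Fin 2) : Continuous fun z : Cut d × Space d => proj z.1.1 z.2 i :=
    (EuclideanSpace.proj i).continuous.comp hprojC
  simp only [offset_eq_height, height_apply, Cut.angle]
  exact (((hcoord 0).mul (by fun_prop)).add ((hcoord 1).mul (by fun_prop))).sub (by fun_prop)

/-- The cut with the same hyperplane and exchanged sides. -/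
noncomputable def Cut.flip (C : Cut d) : Cut d := (C.1, C.2.1 + π, -C.2.2)

lemma continuous_flip : Continuous (Cut.flip : Cut d → Cut d) := by
  unfold Cut.flip
  fun_prop

lemma offset_flip (C : Cut d) (x : Space d) : C.flip.offset x = -C.offset x := by
  rw [offset_eq_height, offset_eq_height]
  simp only [Cut.flip, Cut.angle, height_add_pi]
  ring

lemma rightPart_eq_leftPart_flip (D : Set (Space d)) (C : Cut d) :
    rightPart D C = leftPart D C.flip := by
  simp only [rightPart, leftPart, offset_flip, Left.neg_nonpos_iff]

lemma convex_leftPart {K : Set (Space d)} (hK : Convex ℝ K) (C : Cut d) :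
    Convex ℝ (leftPart K C) := by
  simp only [leftPart, ← offsetₐ_apply]
  exact hK.inter ((convex_Iic (0 : ℝ)).affine_preimage C.offsetₐ)

lemma leftPart_convexHull_nonempty_iff {D : Set (Space d)} {C : Cut d} :
    (leftPart (convexHull ℝ D) C).Nonempty ↔ (leftPart D C).Nonempty := by
  refine ⟨fun ⟨x, hx, hx0⟩ => ?_, fun h => h.mono fun x hx => ⟨subset_convexHull ℝ D hx.1, hx.2⟩⟩
  by_contra hne
  have hpos : D ⊆ C.offsetₐ ⁻¹' Set.Ioi 0 := fun y hy =>
    (lt_of_not_ge fun h => hne ⟨y, hy, h⟩).trans_eq (offsetₐ_apply C y).symm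
  have hx' : 0 < C.offsetₐ x :=
    convexHull_min hpos ((convex_Ioi (0 : ℝ)).affine_preimage C.offsetₐ) hx
  exact hx0.not_gt ((offsetₐ_apply C x).symm ▸ hx')

/-- The cuts with points of `D` on both of their closed sides. -/
def cutsMeeting (D : Set (Space d)) : Set (Cut d) :=
  {C | (leftPart D C).Nonempty ∧ (rightPart D C).Nonempty}

lemma cutsMeeting_convexHull (D : Set (Space d)) :
    cutsMeeting (convexHull ℝ D) = cutsMeeting D := by
  simp only [cutsMeeting, rightPart_eq_leftPart_flip, leftPart_convexHull_nonempty_iff]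

lemma cutsMeeting_mono {D D' : Set (Space d)} (h : D ⊆ convexHull ℝ D') :
    cutsMeeting D ⊆ cutsMeeting D' := by
  rw [← cutsMeeting_convexHull D']
  exact fun C hC => ⟨hC.1.mono fun _ hx => ⟨h hx.1, hx.2⟩, hC.2.mono fun _ hx => ⟨h hx.1, hx.2⟩⟩

lemma hyperplane_nonempty_iff {K : Set (Space d)} (hK : Convex ℝ K) {C : Cut d} :
    (hyperplane K C).Nonempty ↔ C ∈ cutsMeeting K := by
  refine ⟨fun ⟨x, hx, hx0⟩ => ⟨⟨x, hx, hx0.le⟩, x, hx, hx0.ge⟩, ?_⟩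
  rintro ⟨⟨x, hx, hx0⟩, y, hy, hy0⟩
  rw [← offsetₐ_apply] at hx0 hy0
  obtain ⟨z, hz, hz0⟩ := (hK.affine_image C.offsetₐ).ordConnected.out
    (Set.mem_image_of_mem _ hx) (Set.mem_image_of_mem _ hy) ⟨hx0, hy0⟩
  exact ⟨z, hz, (offsetₐ_apply C z).symm.trans hz0⟩

/-! ### Admissible domains -/

/-- The domains on which the cutting recursions run: finite data sets and polytopes. -/
def Admissible (D : Set (Space d)) : Prop := D.Finite ∨ IsPolytope D

namespace Admissible

variable {D : Set (Space d)}

lemma isPolytope_convexHull (hD : Admissible D) : IsPolytope (convexHull ℝ D) := by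
  rcases hD with hfin | hpoly
  · exact isPolytope_convexHull_of_finite hfin
  · rwa [hpoly.convex.convexHull_eq]

lemma isCompact (hD : Admissible D) : IsCompact D :=
  hD.elim Set.Finite.isCompact IsPolytope.isCompact

lemma leftPart (hD : Admissible D) (C : Cut d) : Admissible (leftPart D C) := by
  refine hD.imp (fun hfin => hfin.subset (Set.sep_subset _ _)) fun hpoly => ?_
  simpa only [BSP.leftPart, ← offsetₐ_apply] using hpoly.inter_halfSpace C.offsetₐ

lemma rightPart (hD : Admissible D) (C : Cut d) : Admissible (rightPart D C) := by
  rw [rightPart_eq_leftPart_flip]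
  exact hD.leftPart C.flip

end Admissible

/-! ### Closed families of domains -/

lemma isClosed_exists_mem_of_isCompact {X Y : Type*} [TopologicalSpace X] [TopologicalSpace Y]
    {K : Set Y} (hK : IsCompact K) {R : Set (X × Y)} (hR : IsClosed R) :
    IsClosed {x | ∃ y ∈ K, (x, y) ∈ R} := by
  have : CompactSpace K := isCompact_iff_compactSpace.1 hK
  have hpre : IsClosed ((fun z : X × K => (z.1, (z.2 : Y))) ⁻¹' R) := hR.preimage (by fun_prop)
  convert isClosedMap_fst_of_compactSpace _ hpre using 1
  ext x
  simp only [Set.mem_ofPred_eq, Set.mem_image, Set.mem_preimage, Prod.exists, Subtype.exists,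
    exists_and_right, exists_eq_right, exists_prop]

/-- A family of subsets of a fixed compact set whose graph is closed. Such families make the
measurability in `D` of quantities that depend on a domain `D` accessible: it is tested along
continuous parametrisations of domains. -/
def IsClosedFamily {X Y : Type*} [TopologicalSpace X] [TopologicalSpace Y] (D : X → Set Y) : Prop :=
  IsClosed {z : X × Y | z.2 ∈ D z.1} ∧ ∃ K, IsCompact K ∧ ∀ x, D x ⊆ K

section IsClosedFamily

variable {X Y : Type*} [TopologicalSpace X] [TopologicalSpace Y]

lemma isClosedFamily_const [T2Space Y] {K : Set Y} (hK : IsCompact K) :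
    IsClosedFamily fun _ : X => K :=
  ⟨hK.isClosed.preimage continuous_snd, K, hK, fun _ => subset_rfl⟩

lemma IsClosedFamily.comp {D : X → Set Y} (hD : IsClosedFamily D) {X' : Type*}
    [TopologicalSpace X'] {f : X' → X} (hf : Continuous f) : IsClosedFamily fun x => D (f x) :=
  ⟨hD.1.preimage (by fun_prop : Continuous fun z : X' × Y => (f z.1, z.2)),
    hD.2.imp fun _ hK => ⟨hK.1, fun x => hK.2 (f x)⟩⟩

lemma IsClosedFamily.isClosed_nonempty {D : X → Set Y} (hD : IsClosedFamily D) :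
    IsClosed {x | (D x).Nonempty} := by
  obtain ⟨hclosed, K, hK, hsub⟩ := hD
  convert isClosed_exists_mem_of_isCompact hK hclosed using 1
  ext x
  exact ⟨fun ⟨y, hy⟩ => ⟨y, hsub x hy, hy⟩, fun ⟨y, _, hy⟩ => ⟨y, hy⟩⟩

variable {D : X → Set (Space d)}

lemma IsClosedFamily.leftPart (hD : IsClosedFamily D) {C : X → Cut d} (hC : Continuous C) :
    IsClosedFamily fun x => leftPart (D x) (C x) :=
  ⟨hD.1.inter (isClosed_le (continuous_offset.comp
      (by fun_prop : Continuous fun z : X × Space d => (C z.1, z.2))) continuous_const),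
    hD.2.imp fun _ hK => ⟨hK.1, fun x => (Set.sep_subset _ _).trans (hK.2 x)⟩⟩

lemma IsClosedFamily.rightPart (hD : IsClosedFamily D) {C : X → Cut d} (hC : Continuous C) :
    IsClosedFamily fun x => rightPart (D x) (C x) := by
  simp_rw [rightPart_eq_leftPart_flip]
  exact hD.leftPart (continuous_flip.comp hC)

lemma IsClosedFamily.isClosed_cutsMeeting (hD : IsClosedFamily D) :
    IsClosed {z : X × Cut d | z.2 ∈ cutsMeeting (D z.1)} :=
  ((hD.comp continuous_fst).leftPart continuous_snd).isClosed_nonempty.inter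
    ((hD.comp continuous_fst).rightPart continuous_snd).isClosed_nonempty

lemma measurableSet_cutsMeeting {D : Set (Space d)} (hD : IsCompact D) :
    MeasurableSet (cutsMeeting D) :=
  ((isClosedFamily_const (X := Unit) hD).isClosed_cutsMeeting.preimage
    (by fun_prop : Continuous fun C : Cut d => ((), C))).measurableSet

end IsClosedFamily

/-! ### The law of a generated cut -/

/-- The invariant measure `dθ ds` on the lines of the plane, a line being given by the direction
`θ ∈ (0, π]` of its normal and its height `s` in that direction. -/
noncomputable def lineMeasure : Measure (ℝ × ℝ) :=
  (volume.restrict (Set.Ioc 0 π)).prod volume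

instance : SFinite lineMeasure := by
  unfold lineMeasure
  infer_instance

/-- The lines that meet the planar set `Q`. -/
def linesMeeting (Q : Set Plane) : Set (ℝ × ℝ) := {z | z.2 ∈ dirSegment Q z.1}

section linesMeeting

variable {Q : Set Plane}

lemma isClosed_linesMeeting (hQ : IsCompact Q) : IsClosed (linesMeeting Q) := by
  have hinc : IsClosed {w : (ℝ × ℝ) × Plane | height w.1.1 w.2 = w.1.2} :=
    isClosed_eq (by simp only [height_apply]; fun_prop) (by fun_prop)
  exact isClosed_exists_mem_of_isCompact hQ hinc

lemma lineMeasure_linesMeeting (hQ : IsCompact Q) :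
    lineMeasure (linesMeeting Q) = ∫⁻ θ in Set.Ioc 0 π, volume (dirSegment Q θ) :=
  Measure.prod_apply (isClosed_linesMeeting hQ).measurableSet

lemma measurable_volume_dirSegment (hQ : IsCompact Q) :
    Measurable fun θ => volume (dirSegment Q θ) :=
  measurable_measure_prodMk_left (isClosed_linesMeeting hQ).measurableSet

lemma positionLaw_map_apply (hQ : IsCompact Q) {B : Set (ℝ × ℝ)} (hB : MeasurableSet B) (θ : ℝ) :
    (positionLaw Q θ).map (fun s => (θ, s)) B =
      (volume (dirSegment Q θ))⁻¹ * volume (Prod.mk θ ⁻¹' (linesMeeting Q ∩ B)) := by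
  have hdir : MeasurableSet (dirSegment Q θ) :=
    measurable_prodMk_left (isClosed_linesMeeting hQ).measurableSet
  rw [Measure.map_apply (by fun_prop) hB, positionLaw, cond_apply hdir]
  rfl

lemma measurable_positionLaw_map (hQ : IsCompact Q) :
    Measurable fun θ => (positionLaw Q θ).map fun s => (θ, s) := by
  refine Measure.measurable_of_measurable_coe _ fun B hB => ?_
  simp_rw [positionLaw_map_apply hQ hB]
  exact (measurable_volume_dirSegment hQ).inv.mul
    (measurable_measure_prodMk_left ((isClosed_linesMeeting hQ).measurableSet.inter hB))

/-- The density of the angle cancels the normalisation of the position. -/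
theorem lineLaw_eq_cond (hQ : IsCompact Q) : lineLaw Q = cond lineMeasure (linesMeeting Q) := by
  have hL := (isClosed_linesMeeting hQ).measurableSet
  have hmeas := measurable_positionLaw_map hQ
  ext B hB
  have hmeasB : Measurable fun θ => (positionLaw Q θ).map (fun s => (θ, s)) B :=
    (Measure.measurable_coe hB).comp hmeas
  rw [cond_apply hL, lineLaw, Measure.bind_apply hB hmeas.aemeasurable, angleLaw,
    lintegral_smul_measure, ← lineMeasure_linesMeeting hQ, smul_eq_mul,
    lintegral_withDensity_eq_lintegral_mul _ (measurable_volume_dirSegment hQ) hmeasB,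
    lineMeasure, Measure.prod_apply (hL.inter hB)]
  congr 1
  refine lintegral_congr fun θ => ?_
  rw [Pi.mul_apply, positionLaw_map_apply hQ hB, ← mul_assoc]
  have hfin : volume (dirSegment Q θ) ≠ ⊤ :=
    (hQ.image (height θ).continuous).measure_lt_top.ne
  rcases eq_or_ne (volume (dirSegment Q θ)) 0 with h0 | h0
  · have hnull : volume (Prod.mk θ ⁻¹' (linesMeeting Q ∩ B)) = 0 :=
      measure_mono_null (fun s hs => hs.1) h0
    rw [hnull, mul_zero]
  · rw [ENNReal.mul_inv_cancel h0 hfin, one_mul]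

end linesMeeting

/-- The measure on all cuts of which the law of a generated cut is a restriction, normalised. -/
noncomputable def cutMeasure (d : ℕ) : Measure (Cut d) := Measure.count.prod lineMeasure

instance : SFinite (cutMeasure d) := by
  unfold cutMeasure
  infer_instance

lemma cutMeasure_apply {B : Set (Cut d)} (hB : MeasurableSet B) :
    cutMeasure d B = ∑ p, lineMeasure (Prod.mk p ⁻¹' B) := by
  rw [cutMeasure, Measure.prod_apply hB, lintegral_count, tsum_fintype]

section cutLaw

variable {K : Set (Space d)}

lemma linesMeeting_proj (hK : Convex ℝ K) (p : DimPair d) :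
    linesMeeting (proj p '' K) = Prod.mk p ⁻¹' cutsMeeting K := by
  ext ⟨θ, s⟩
  rw [Set.mem_preimage, ← hyperplane_nonempty_iff hK, linesMeeting, Set.mem_ofPred_eq,
    dirSegment_eq_image_height, ← Set.image_comp]
  refine exists_congr fun x => and_congr_right fun _ => ?_
  rw [offset_eq_height, sub_eq_zero]
  rfl

lemma isPolytope_proj (hK : IsPolytope K) (p : DimPair d) : IsPolytope (proj p '' K) :=
  hK.linear_image (projₗ p)

lemma perimeter_proj (hK : IsPolytope K) (p : DimPair d) :
    perimeter (proj p '' K) = lineMeasure (Prod.mk p ⁻¹' cutsMeeting K) := by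
  rw [perimeter_eq_lintegral (isPolytope_proj hK p), ← linesMeeting_proj hK.convex,
    lineMeasure_linesMeeting (isPolytope_proj hK p).isCompact]

lemma totalPerimeter_eq (hK : IsPolytope K) :
    totalPerimeter K = cutMeasure d (cutsMeeting K) := by
  rw [totalPerimeter, cutMeasure_apply (measurableSet_cutsMeeting hK.isCompact)]
  exact Finset.sum_congr rfl fun p _ => perimeter_proj hK p

lemma totalPerimeter_ne_top (hK : IsPolytope K) : totalPerimeter K ≠ ⊤ :=
  ENNReal.sum_ne_top.2 fun p _ => perimeter_ne_top (isPolytope_proj hK p)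

theorem cutLaw_eq_cond (hK : IsPolytope K) :
    cutLaw K = cond (cutMeasure d) (cutsMeeting K) := by
  have hmk (p : DimPair d) : Measurable fun y : ℝ × ℝ => (p, y) := measurable_prodMk_left
  have hmeet := measurableSet_cutsMeeting hK.isCompact
  ext B hB
  rw [cond_apply hmeet, cutLaw, Measure.bind_apply hB (measurable_of_countable _).aemeasurable,
    pairLaw, lintegral_finsetSum_measure, cutMeasure_apply (hmeet.inter hB),
    ← totalPerimeter_eq hK, Finset.mul_sum]
  refine Finset.sum_congr rfl fun p _ => ?_
  rw [lintegral_smul_measure, lintegral_dirac, Measure.map_apply (hmk p) hB,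
    lineLaw_eq_cond (isPolytope_proj hK p).isCompact, linesMeeting_proj hK.convex,
    cond_apply (hmk p hmeet), ← perimeter_proj hK, ← Set.preimage_inter, smul_eq_mul]
  rcases eq_or_ne (perimeter (proj p '' K)) 0 with h0 | h0
  · have hnull : lineMeasure (Prod.mk p ⁻¹' (cutsMeeting K ∩ B)) = 0 :=
      measure_mono_null (Set.preimage_mono Set.inter_subset_left) (perimeter_proj hK p ▸ h0)
    rw [hnull, mul_zero, mul_zero, mul_zero]
  · rw [ENNReal.div_eq_inv_mul, mul_assoc, ← mul_assoc (perimeter _),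
      ENNReal.mul_inv_cancel h0 (perimeter_ne_top (isPolytope_proj hK p)), one_mul]

end cutLaw

/-- The rate at which the recursion on the domain `D` cuts: the total perimeter of the convex hull
of `D`, by `ofReal_rate`. -/
noncomputable def rate (D : Set (Space d)) : ℝ := (cutMeasure d (cutsMeeting D)).toReal

section rate

variable {D D' : Set (Space d)}

lemma rate_nonneg (D : Set (Space d)) : 0 ≤ rate D := ENNReal.toReal_nonneg

lemma Admissible.totalPerimeter_convexHull (hD : Admissible D) :
    totalPerimeter (convexHull ℝ D) = cutMeasure d (cutsMeeting D) := by
  rw [totalPerimeter_eq hD.isPolytope_convexHull, cutsMeeting_convexHull]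

lemma Admissible.cutLaw_convexHull (hD : Admissible D) :
    cutLaw (convexHull ℝ D) = cond (cutMeasure d) (cutsMeeting D) := by
  rw [cutLaw_eq_cond hD.isPolytope_convexHull, cutsMeeting_convexHull]

lemma Admissible.cutMeasure_ne_top (hD : Admissible D) : cutMeasure d (cutsMeeting D) ≠ ⊤ :=
  hD.totalPerimeter_convexHull ▸ totalPerimeter_ne_top hD.isPolytope_convexHull

lemma ofReal_rate (hD : Admissible D) :
    ENNReal.ofReal (rate D) = cutMeasure d (cutsMeeting D) :=
  ENNReal.ofReal_toReal hD.cutMeasure_ne_top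

lemma rate_mono (hD' : Admissible D') (h : D ⊆ convexHull ℝ D') : rate D ≤ rate D' :=
  ENNReal.toReal_mono hD'.cutMeasure_ne_top (measure_mono (cutsMeeting_mono h))

end rate

/-! ### Measurability on trees -/

namespace BinTree

variable {α : Type}

/-- The first subtree, with a leaf as junk value on leaves. -/
def left : BinTree α → BinTree α
  | .leaf => .leaf
  | .node _ l _ => l

/-- The second subtree, with a leaf as junk value on leaves. -/
def right : BinTree α → BinTree α
  | .leaf => .leaf
  | .node _ _ r => r

/-- The number of levels of inner nodes. -/
def depth : BinTree α → ℕ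
  | .leaf => 0
  | .node _ l r => max l.depth r.depth + 1

/-- The first `n` levels of a tree. -/
def truncate : ℕ → BinTree α → BinTree α
  | 0, _ => .leaf
  | _ + 1, .leaf => .leaf
  | n + 1, .node a l r => .node a (l.truncate n) (r.truncate n)

lemma truncate_of_depth_le {t : BinTree α} {n : ℕ} (h : t.depth ≤ n) : t.truncate n = t := by
  induction t generalizing n with
  | leaf => cases n <;> rfl
  | node a l r ihl ihr =>
    obtain _ | n := n
    · exact absurd h (Nat.not_succ_le_zero _)
    · obtain ⟨hl, hr⟩ := max_le_iff.1 (Nat.le_of_succ_le_succ h)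
      rw [truncate, ihl hl, ihr hr]

variable [MeasurableSpace α]

lemma measurable_label (w : List Bool) : Measurable fun t : BinTree α => t.label w :=
  (measurable_pi_apply w).comp (comap_measurable _)

lemma measurable_iff_label {Y : Type*} [MeasurableSpace Y] {f : Y → BinTree α} :
    Measurable f ↔ ∀ w, Measurable fun y => (f y).label w :=
  measurable_comap_iff.trans measurable_pi_iff

lemma measurable_node :
    Measurable fun z : α × BinTree α × BinTree α => BinTree.node z.1 z.2.1 z.2.2 := by
  refine measurable_iff_label.2 fun w => ?_
  rcases w with _ | ⟨_ | _, w⟩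
  · exact measurable_inr.comp measurable_fst
  · exact (measurable_label w).comp (measurable_fst.comp measurable_snd)
  · exact (measurable_label w).comp (measurable_snd.comp measurable_snd)

lemma measurable_left : Measurable (left : BinTree α → BinTree α) := by
  refine measurable_iff_label.2 fun w => ?_
  convert measurable_label (α := α) (false :: w) using 2 with t
  cases t <;> rfl

lemma measurable_right : Measurable (right : BinTree α → BinTree α) := by
  refine measurable_iff_label.2 fun w => ?_
  convert measurable_label (α := α) (true :: w) using 2 with t
  cases t <;> rfl

lemma measurableSet_singleton_leaf : MeasurableSet {(leaf : BinTree α)} := by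
  convert measurable_label (α := α) [] measurableSet_range_inl using 1
  ext t
  cases t <;> simp [label]

/-- The coordinates of a node are measurable functions of the tree, so that measurability on trees
can be checked separately on leaves and on nodes. -/
lemma measurable_of_leaf_of_node {Y Z : Type*} [MeasurableSpace Y] [MeasurableSpace Z]
    {F : BinTree α × Y → Z} (hleaf : Measurable fun y => F (leaf, y))
    (hnode : Measurable fun w : (α × BinTree α × BinTree α) × Y =>
      F (node w.1.1 w.1.2.1 w.1.2.2, w.2)) : Measurable F := by
  classical
  rcases isEmpty_or_nonempty α with hα | ⟨⟨a₀⟩⟩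
  · convert hleaf.comp (measurable_snd : Measurable (Prod.snd : BinTree α × Y → Y)) using 1
    ext ⟨t, y⟩
    cases t with
    | leaf => rfl
    | node a l r => exact hα.elim a
  · set root : BinTree α → α := fun t => (t.label []).elim (fun _ => a₀) id with hroot
    have hrootm : Measurable root :=
      (Measurable.sumElim measurable_const measurable_id).comp (measurable_label [])
    have hF : F = fun z => if z.1 ∈ ({leaf} : Set (BinTree α)) then F (leaf, z.2)
        else F (node (root z.1) z.1.left z.1.right, z.2) := by
      ext ⟨t, y⟩
      cases t with
      | leaf => simp
      | node a l r => simp [hroot, label, left, right]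
    rw [hF]
    refine Measurable.ite (measurable_fst measurableSet_singleton_leaf)
      (hleaf.comp measurable_snd)
      (hnode.comp (f := fun z : BinTree α × Y => ((root z.1, z.1.left, z.1.right), z.2)) ?_)
    exact ((hrootm.comp measurable_fst).prodMk ((measurable_left.comp measurable_fst).prodMk
      (measurable_right.comp measurable_fst))).prodMk measurable_snd

end BinTree

/-! ### The restriction of a tree -/

/-- The restriction of a tree to the convex hulls of the domain `D`, with accumulated cost `a`. It
also covers the restriction to a convex block, by `restrictFrom_id`. -/
noncomputable def restrictHull (t : CutTree d) (D : Set (Space d)) (a : ℝ) : CutTree d :=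
  restrictFrom (fun A => convexHull ℝ A) t D a

lemma hyperplane_convexHull_nonempty_iff {D : Set (Space d)} {C : Cut d} :
    (hyperplane (convexHull ℝ D) C).Nonempty ↔ C ∈ cutsMeeting D := by
  rw [hyperplane_nonempty_iff (convex_convexHull ℝ D), cutsMeeting_convexHull]

open Classical in
lemma restrictHull_node (e : ℝ × Cut d) (l r : CutTree d) (D : Set (Space d)) (a : ℝ) :
    restrictHull (.node e l r) D a =
      if e.2 ∈ cutsMeeting D then
        .node (a + e.1, e.2) (restrictHull l (leftPart D e.2) 0)
          (restrictHull r (rightPart D e.2) 0)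
      else if (rightPart D e.2).Nonempty then restrictHull r D (a + e.1)
      else restrictHull l D (a + e.1) := by
  obtain ⟨c, C⟩ := e
  simp only [restrictHull]
  rw [restrictFrom, hyperplane_convexHull_nonempty_iff]
  by_cases hC : C ∈ cutsMeeting D
  · simp only [if_pos hC]
  have hside : leftPart D C = D ↔ ¬ (rightPart D C).Nonempty := by
    refine ⟨fun hl ⟨x, hx⟩ => hC ⟨⟨x, hl.symm.subset hx.1⟩, x, hx⟩, fun hr => ?_⟩
    exact (Set.sep_subset _ _).antisymm fun x hx =>
      ⟨hx, (not_le.1 fun h0 => hr ⟨x, hx, h0⟩).le⟩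
  simp only [if_neg hC, hside, ite_not]

lemma measurable_restrictHull_truncate (n : ℕ) {X : Type} [TopologicalSpace X]
    [SecondCountableTopology X] [MeasurableSpace X] [BorelSpace X] {D : X → Set (Space d)}
    (hD : IsClosedFamily D) :
    Measurable fun z : CutTree d × X × ℝ => restrictHull (z.1.truncate n) (D z.2.1) z.2.2 := by
  induction n generalizing X D with
  | zero => exact measurable_const
  | succ n ih =>
    refine BinTree.measurable_of_leaf_of_node measurable_const ?_
    let Node := ((ℝ × Cut d) × CutTree d × CutTree d) × X × ℝ
    have hxC : Measurable fun w : Node => (w.2.1, w.1.1.2) := by fun_prop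
    have hDfst : IsClosedFamily fun z : X × Cut d => D z.1 := hD.comp continuous_fst
    have hl := hDfst.leftPart continuous_snd
    have hr := hDfst.rightPart continuous_snd
    simp only [BinTree.truncate, restrictHull_node]
    refine Measurable.ite (hxC hD.isClosed_cutsMeeting.measurableSet)
      (BinTree.measurable_node.comp (Measurable.prodMk (by fun_prop) (Measurable.prodMk ?_ ?_)))
      (Measurable.ite (hxC hr.isClosed_nonempty.measurableSet) ?_ ?_)
    · exact (ih hl).comp (f := fun w : Node => (w.1.2.1, (w.2.1, w.1.1.2), 0)) (by fun_prop)
    · exact (ih hr).comp (f := fun w : Node => (w.1.2.2, (w.2.1, w.1.1.2), 0)) (by fun_prop)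
    · exact (ih hD).comp (f := fun w : Node => (w.1.2.2, w.2.1, w.2.2 + w.1.1.1)) (by fun_prop)
    · exact (ih hD).comp (f := fun w : Node => (w.1.2.1, w.2.1, w.2.2 + w.1.1.1)) (by fun_prop)

lemma measurable_of_eventually_eq {Y Z : Type*} [MeasurableSpace Y] [MeasurableSpace Z]
    {f : Y → Z} {g : ℕ → Y → Z} (hg : ∀ n, Measurable (g n))
    (h : ∀ y, ∀ᶠ n in Filter.atTop, g n y = f y) : Measurable f := by
  intro B hB
  have hlim : f ⁻¹' B = Filter.liminf (fun n => g n ⁻¹' B) Filter.atTop := by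
    ext y
    have hiff : (∀ᶠ n in Filter.atTop, g n y ∈ B) ↔ ∀ᶠ _ in (Filter.atTop : Filter ℕ), f y ∈ B :=
      Filter.eventually_congr ((h y).mono fun n hn => by rw [hn])
    rw [Filter.mem_liminf_iff_eventually_mem]
    exact Filter.eventually_const.symm.trans hiff.symm
  rw [hlim]
  exact .measurableSet_liminf fun n => hg n hB

lemma measurable_restrictHull {D : Set (Space d)} (hD : IsCompact D) (a : ℝ) :
    Measurable fun t : CutTree d => restrictHull t D a :=
  measurable_of_eventually_eq
    (fun n => (measurable_restrictHull_truncate n (isClosedFamily_const (X := Unit) hD)).comp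
      (f := fun t => (t, (), a)) (by fun_prop))
    fun t => (Filter.eventually_ge_atTop t.depth).mono fun n hn => by
      simp only [Function.comp_apply, BinTree.truncate_of_depth_le hn]

/-- The tree with `a` added to the cost of its first cut. -/
def shift (a : ℝ) : CutTree d → CutTree d
  | .leaf => .leaf
  | .node (c, C) l r => .node (a + c, C) l r

lemma measurable_shift (a : ℝ) : Measurable (shift a : CutTree d → CutTree d) := by
  have hunit : Measurable fun z : CutTree d × Unit => shift a z.1 :=
    BinTree.measurable_of_leaf_of_node measurable_const
      (BinTree.measurable_node.comp (f := fun w : ((ℝ × Cut d) × CutTree d × CutTree d) × Unit =>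
        ((a + w.1.1.1, w.1.1.2), w.1.2.1, w.1.2.2)) (by fun_prop))
  exact hunit.comp (f := fun t => (t, ())) (by fun_prop)

lemma shift_add (a b : ℝ) (t : CutTree d) : shift (a + b) t = shift a (shift b t) := by
  cases t with
  | leaf => rfl
  | node => simp only [shift, add_assoc]

lemma restrictHull_eq_shift (t : CutTree d) (D : Set (Space d)) (a : ℝ) :
    restrictHull t D a = shift a (restrictHull t D 0) := by
  induction t generalizing D a with
  | leaf => rfl
  | node e l r ihl ihr =>
    rw [restrictHull_node, restrictHull_node]
    split_ifs
    · simp only [shift, zero_add]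
    · rw [ihr, ihr D (0 + e.1), zero_add, shift_add]
    · rw [ihl, ihl D (0 + e.1), zero_add, shift_add]

/-! ### Exponential clocks -/

/-- The expected value of a quantity that equals `G c` if a clock of rate `r` rings at a time
`c < τ`, and `l` if it does not ring before `τ`, for `g = r * G`. With the rate factor in `g`, the
clock that never rings is the case `r = 0`, `g = 0`. -/
noncomputable def clockIntegral (r τ : ℝ) (g : ℝ → ENNReal) (l : ENNReal) : ENNReal :=
  (∫⁻ c in Set.Ico 0 τ, ENNReal.ofReal (Real.exp (-(r * c))) * g c) +
    ENNReal.ofReal (Real.exp (-(r * max τ 0))) * l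

lemma clockIntegral_of_nonpos (r : ℝ) {τ : ℝ} (hτ : τ ≤ 0) (g : ℝ → ENNReal) (l : ENNReal) :
    clockIntegral r τ g l = l := by
  simp [clockIntegral, Set.Ico_eq_empty (not_lt.2 hτ), max_eq_right hτ]

lemma clockIntegral_mono {r τ : ℝ} {g g' : ℝ → ENNReal} (h : ∀ c, 0 ≤ c → c < τ → g c ≤ g' c)
    (l : ENNReal) : clockIntegral r τ g l ≤ clockIntegral r τ g' l :=
  add_le_add_left (setLIntegral_mono' measurableSet_Ico fun c hc =>
    mul_le_mul_right (h c hc.1 hc.2) _) _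

lemma clockIntegral_add {r τ : ℝ} {g h : ℝ → ENNReal} (hh : Measurable h) (l : ENNReal) :
    clockIntegral r τ (fun c => g c + h c) l =
      clockIntegral r τ g l + ∫⁻ c in Set.Ico 0 τ, ENNReal.ofReal (Real.exp (-(r * c))) * h c := by
  simp_rw [clockIntegral, mul_add]
  rw [lintegral_add_right _ (by fun_prop), add_right_comm]

lemma measurable_clockIntegral {Y : Type*} [MeasurableSpace Y] {r τ : Y → ℝ} (hr : Measurable r)
    (hτ : Measurable τ) {g : Y → ℝ → ENNReal} (hg : Measurable (Function.uncurry g))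
    (l : ENNReal) : Measurable fun y => clockIntegral (r y) (τ y) (g y) l := by
  simp only [clockIntegral, ← lintegral_indicator measurableSet_Ico]
  refine .add (.lintegral_prod_right' (f := fun z : Y × ℝ => (Set.Ico 0 (τ z.1)).indicator
    (fun c => ENNReal.ofReal (Real.exp (-(r z.1 * c))) * g z.1 c) z.2) ?_) (by fun_prop)
  refine .indicator (s := {z : Y × ℝ | 0 ≤ z.2 ∧ z.2 < τ z.1})
    (f := fun z : Y × ℝ => ENNReal.ofReal (Real.exp (-(r z.1 * z.2))) * g z.1 z.2)
    (.mul (by fun_prop) hg) ?_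
  exact (measurableSet_le measurable_const measurable_snd).inter
    (measurableSet_lt measurable_snd (hτ.comp measurable_fst))

lemma setLIntegral_exp {k x : ℝ} (hk : 0 ≤ k) (hx : 0 ≤ x) :
    ∫⁻ c in Set.Ico 0 x, ENNReal.ofReal (k * Real.exp (-(k * c))) =
      ENNReal.ofReal (1 - Real.exp (-(k * x))) := by
  have hc : Continuous fun c => k * Real.exp (-(k * c)) := by fun_prop
  have hderiv : ∀ c ∈ Set.uIcc 0 x, HasDerivAt (fun c => -Real.exp (-(k * c)))
      (k * Real.exp (-(k * c))) c := fun c _ => hasDerivAt_neg_exp_mul_exp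
  rw [Measure.restrict_congr_set Ico_ae_eq_Ioc, ← ofReal_integral_eq_lintegral_ofReal
      hc.integrableOn_Ioc (Filter.Eventually.of_forall fun c => by positivity),
    ← intervalIntegral.integral_of_le hx,
    intervalIntegral.integral_eq_sub_of_hasDerivAt hderiv (hc.intervalIntegrable _ _)]
  congr 1
  rw [mul_zero, neg_zero, Real.exp_zero]
  ring

lemma setLIntegral_exp_add {k x : ℝ} (hk : 0 ≤ k) (hx : 0 ≤ x) :
    (∫⁻ c in Set.Ico 0 x, ENNReal.ofReal (k * Real.exp (-(k * c)))) +
      ENNReal.ofReal (Real.exp (-(k * x))) = 1 := by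
  have hle : Real.exp (-(k * x)) ≤ 1 := Real.exp_le_one_iff.2 (neg_nonpos.2 (mul_nonneg hk hx))
  rw [setLIntegral_exp hk hx, ← ENNReal.ofReal_add (sub_nonneg.2 hle) (Real.exp_pos _).le,
    sub_add_cancel, ENNReal.ofReal_one]

lemma clockIntegral_rate_one {r : ℝ} (hr : 0 ≤ r) (τ : ℝ) :
    clockIntegral r τ (fun _ => ENNReal.ofReal r) 1 = 1 := by
  rcases le_total τ 0 with hτ | hτ
  · exact clockIntegral_of_nonpos r hτ _ _
  · simp_rw [clockIntegral, mul_comm _ (ENNReal.ofReal r), ← ENNReal.ofReal_mul hr, max_eq_left hτ,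
      mul_one, setLIntegral_exp_add hr hτ]

lemma setLIntegral_Ici_exponentialPDF {r x : ℝ} (hr : 0 < r) (hx : 0 ≤ x) :
    ∫⁻ c in Set.Ici x, exponentialPDF r c = ENNReal.ofReal (Real.exp (-(r * x))) := by
  have hle : Real.exp (-(r * x)) ≤ 1 :=
    Real.exp_le_one_iff.2 (neg_nonpos.2 (mul_nonneg hr.le hx))
  have hcompl := lintegral_add_compl (μ := volume) (exponentialPDF r) (measurableSet_Iic (a := x))
  rw [lintegral_exponentialPDF_eq_one hr, lintegral_exponentialPDF_eq_antiDeriv hr, if_pos hx,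
    Set.compl_Iic] at hcompl
  rw [Measure.restrict_congr_set Ioi_ae_eq_Ici.symm]
  refine (ENNReal.add_right_inj (ENNReal.ofReal_ne_top (r := 1 - Real.exp (-(r * x))))).1 ?_
  rw [hcompl, ← ENNReal.ofReal_add (sub_nonneg.2 hle) (Real.exp_pos _).le, sub_add_cancel,
    ENNReal.ofReal_one]

lemma lintegral_expMeasure_ite {r : ℝ} (hr : 0 < r) (τ : ℝ) {G : ℝ → ENNReal} (hG : Measurable G)
    (l : ENNReal) :
    ∫⁻ c, (if c < τ then G c else l) ∂expMeasure r =
      clockIntegral r τ (fun c => ENNReal.ofReal r * G c) l := by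
  have hpdf : Measurable (exponentialPDF r) := (measurable_exponentialPDFReal r).ennreal_ofReal
  have hite : Measurable fun c => if c < τ then G c else l :=
    Measurable.ite measurableSet_Iio hG measurable_const
  have hdensity : ∫⁻ c, (if c < τ then G c else l) ∂expMeasure r =
      ∫⁻ c, exponentialPDF r c * (if c < τ then G c else l) :=
    lintegral_withDensity_eq_lintegral_mul _ hpdf hite
  have hneg : ∫⁻ c in Set.Iio 0, exponentialPDF r c * (if c < τ then G c else l) = 0 :=
    setLIntegral_eq_zero measurableSet_Iio fun c hc => by
      rw [exponentialPDF_of_neg hc, zero_mul, Pi.zero_apply]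
  have hIco : Set.Ico (0 : ℝ) τ = Set.Ico 0 (max τ 0) := by
    ext c
    simp only [Set.mem_Ico, lt_max_iff]
    exact ⟨fun h => ⟨h.1, .inl h.2⟩, fun h => ⟨h.1, h.2.resolve_right h.1.not_gt⟩⟩
  rw [hdensity, ← lintegral_add_compl _ (measurableSet_Iio (a := (0 : ℝ))), hneg, zero_add,
    Set.compl_Iio, ← Set.Ico_union_Ici_eq_Ici (le_max_right τ 0), lintegral_union measurableSet_Ici
      (Set.disjoint_left.2 fun c hc hc' => (Set.mem_Ici.1 hc').not_gt hc.2), ← hIco, clockIntegral]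
  congr 1
  · refine setLIntegral_congr_fun measurableSet_Ico fun c hc => ?_
    simp only [if_pos hc.2, exponentialPDF_of_nonneg hc.1, ENNReal.ofReal_mul hr.le]
    ring
  · rw [← setLIntegral_Ici_exponentialPDF hr (le_max_right τ 0), ← lintegral_mul_const _ hpdf]
    exact setLIntegral_congr_fun measurableSet_Ici fun c hc => by
      simp only [if_neg ((le_max_left τ 0).trans hc).not_gt]

lemma setLIntegral_Ico_sub (φ : ℝ → ENNReal) (c τ : ℝ) :
    ∫⁻ b in Set.Ico 0 (τ - c), φ b = ∫⁻ e in Set.Ico c τ, φ (e - c) := by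
  rw [← lintegral_indicator measurableSet_Ico, ← lintegral_indicator measurableSet_Ico,
    ← lintegral_sub_right_eq_self _ c]
  refine lintegral_congr fun e => ?_
  simp only [Set.indicator_apply, Set.mem_Ico, sub_nonneg, sub_lt_sub_iff_right]

lemma setLIntegral_Ico_swap {f : ℝ → ℝ → ENNReal} (hf : Measurable (Function.uncurry f)) (τ : ℝ) :
    ∫⁻ c in Set.Ico 0 τ, ∫⁻ e in Set.Ico c τ, f c e =
      ∫⁻ e in Set.Ico 0 τ, ∫⁻ c in Set.Ico 0 e, f c e := by
  calc ∫⁻ c in Set.Ico 0 τ, ∫⁻ e in Set.Ico c τ, f c e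
      = ∫⁻ c in Set.Ico 0 τ, ∫⁻ e in Set.Ico 0 τ, (Set.Ici c).indicator (f c) e := by
        refine setLIntegral_congr_fun measurableSet_Ico fun c hc => ?_
        have hIco : Set.Ici c ∩ Set.Ico 0 τ = Set.Ico c τ := by
          ext e
          exact ⟨fun h => ⟨h.1, h.2.2⟩, fun h => ⟨h.1, hc.1.trans h.1, h.2⟩⟩
        simp only [setLIntegral_indicator measurableSet_Ici, hIco]
    _ = ∫⁻ e in Set.Ico 0 τ, ∫⁻ c in Set.Ico 0 τ, (Set.Ici c).indicator (f c) e :=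
        lintegral_lintegral_swap
          (hf.indicator (measurableSet_le measurable_fst measurable_snd)).aemeasurable
    _ = ∫⁻ e in Set.Ico 0 τ, ∫⁻ c in Set.Ico 0 e, f c e := by
        refine setLIntegral_congr_fun measurableSet_Ico fun e he => ?_
        have hIcc : Set.Iic e ∩ Set.Ico 0 τ = Set.Icc 0 e := by
          ext c
          exact ⟨fun h => ⟨h.2.1, h.1⟩, fun h => ⟨h.2, h.1, h.2.trans_lt he.2⟩⟩
        simp only [Measure.restrict_congr_set (Ico_ae_eq_Icc (a := 0) (b := e)), ← hIcc,
          ← setLIntegral_indicator measurableSet_Iic]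
        rfl

lemma exp_mul_clockIntegral_sub (r : ℝ) {c τ : ℝ} (h : c ≤ τ) {g : ℝ → ENNReal}
    (hg : Measurable g) (l : ENNReal) :
    ENNReal.ofReal (Real.exp (-(r * c))) * clockIntegral r (τ - c) (fun b => g (c + b)) l =
      (∫⁻ e in Set.Ico c τ, ENNReal.ofReal (Real.exp (-(r * e))) * g e) +
        ENNReal.ofReal (Real.exp (-(r * τ))) * l := by
  have hexp (e : ℝ) : ENNReal.ofReal (Real.exp (-(r * c))) *
      ENNReal.ofReal (Real.exp (-(r * (e - c)))) = ENNReal.ofReal (Real.exp (-(r * e))) := by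
    rw [← ENNReal.ofReal_mul (Real.exp_pos _).le, ← Real.exp_add]
    ring_nf
  rw [clockIntegral, max_eq_left (sub_nonneg.2 h), setLIntegral_Ico_sub, mul_add, ← mul_assoc, hexp,
    ← lintegral_const_mul _ (by fun_prop)]
  simp_rw [← mul_assoc, hexp, add_sub_cancel]

/-- A function may be integrated by summing its values up to the ring of a clock, each weighted with
the probability that the clock has not rung, and the whole remaining integral at the ring. -/
lemma clockIntegral_add_setLIntegral {k τ : ℝ} (hk : 0 ≤ k) (hτ : 0 ≤ τ) {h : ℝ → ENNReal}
    (hh : Measurable h) (w : ENNReal) :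
    clockIntegral k τ (fun c => h c + ENNReal.ofReal k * ((∫⁻ e in Set.Ico c τ, h e) + w)) w =
      (∫⁻ e in Set.Ico 0 τ, h e) + w := by
  set y : ℝ → ENNReal := fun c => ENNReal.ofReal (k * Real.exp (-(k * c)))
  set z : ℝ → ENNReal := fun c => ENNReal.ofReal (Real.exp (-(k * c)))
  have hym : Measurable y := by fun_prop
  have hzm : Measurable z := by fun_prop
  have hexpand (c : ℝ) : z c * (h c + ENNReal.ofReal k * ((∫⁻ e in Set.Ico c τ, h e) + w)) =
      z c * h c + (∫⁻ e in Set.Ico c τ, y c * h e) + y c * w := by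
    have hyz : y c = ENNReal.ofReal k * z c := ENNReal.ofReal_mul hk
    rw [lintegral_const_mul _ hh, hyz]
    ring
  have hmass {b : ℝ} (hb : 0 ≤ b) (v : ENNReal) :
      z b * v + (∫⁻ c in Set.Ico 0 b, y c * v) = v := by
    rw [lintegral_mul_const _ hym, ← add_mul, add_comm, setLIntegral_exp_add hk hb, one_mul]
  have huncurry : Measurable (Function.uncurry fun c e => y c * h e) := by fun_prop
  rw [clockIntegral, max_eq_left hτ, lintegral_congr hexpand, lintegral_add_right _ (by fun_prop),
    lintegral_add_left (by fun_prop), setLIntegral_Ico_swap huncurry,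
    ← lintegral_add_left (by fun_prop), add_assoc, add_comm (∫⁻ c in _, y c * w), hmass hτ,
    setLIntegral_congr_fun measurableSet_Ico fun e he => hmass he.1 (h e)]

/-- Memorylessness: an exponential clock of rate `m` may be simulated by a clock of a higher rate
`M` that is restarted after each of its rings with probability `(M - m) / M`. -/
lemma exponential_thinning {M m : ℝ} (hmM : m ≤ M) (τ : ℝ) {g : ℝ → ENNReal} (hg : Measurable g)
    (l : ENNReal) :
    clockIntegral M τ (fun c => g c +
      ENNReal.ofReal (M - m) * clockIntegral m (τ - c) (fun b => g (c + b)) l) l =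
    clockIntegral m τ g l := by
  rcases le_total τ 0 with hτ | hτ
  · simp only [clockIntegral_of_nonpos _ hτ]
  obtain ⟨k, hk, rfl⟩ : ∃ k, 0 ≤ k ∧ M = k + m := ⟨M - m, sub_nonneg.2 hmM, by ring⟩
  set x : ℝ → ENNReal := fun c => ENNReal.ofReal (Real.exp (-(m * c)))
  have hxg : Measurable fun c => x c * g c := by fun_prop
  have hexp (c : ℝ) : ENNReal.ofReal (Real.exp (-((k + m) * c))) =
      ENNReal.ofReal (Real.exp (-(k * c))) * x c := by
    rw [← ENNReal.ofReal_mul (Real.exp_pos _).le, ← Real.exp_add]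
    ring_nf
  have hrestart : ∀ c ∈ Set.Ico 0 τ, ENNReal.ofReal (Real.exp (-((k + m) * c))) * (g c +
      ENNReal.ofReal k * clockIntegral m (τ - c) (fun b => g (c + b)) l) =
      ENNReal.ofReal (Real.exp (-(k * c))) * (x c * g c +
        ENNReal.ofReal k * ((∫⁻ e in Set.Ico c τ, x e * g e) + x τ * l)) := by
    intro c hc
    rw [← exp_mul_clockIntegral_sub m hc.2.le hg l, hexp]
    ring
  have hk_clock := clockIntegral_add_setLIntegral hk hτ hxg (x τ * l)
  rw [clockIntegral, max_eq_left hτ] at hk_clock ⊢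
  rw [add_sub_cancel_right, setLIntegral_congr_fun measurableSet_Ico hrestart, hexp, mul_assoc,
    hk_clock, clockIntegral, max_eq_left hτ]

/-! ### Suprema of increasing sequences of measures -/

lemma iSup_measure_apply {Y : Type*} [MeasurableSpace Y] {μ : ℕ → Measure Y} (hμ : Monotone μ)
    {B : Set Y} (hB : MeasurableSet B) : (⨆ n, μ n) B = ⨆ n, μ n B := by
  refine le_antisymm ?_ (iSup_le fun n => le_iSup μ n B)
  set ν : Measure Y := Measure.ofMeasurable (fun s _ => ⨆ n, μ n s) (by simp) (by
    intro f hf hd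
    have hmono : Monotone fun n i => μ n (f i) := fun a b h i => hμ h (f i)
    have hcount (n : ℕ) : μ n (⋃ i, f i) = ∫⁻ i, μ n (f i) ∂Measure.count := by
      rw [measure_iUnion hd hf, lintegral_count]
    simp_rw [hcount]
    rw [← lintegral_iSup (fun n => measurable_of_countable _) hmono, lintegral_count])
  have hν {s : Set Y} (hs : MeasurableSet s) : ν s = ⨆ n, μ n s := Measure.ofMeasurable_apply s hs
  have hle : ⨆ n, μ n ≤ ν := iSup_le fun n => Measure.le_iff.2 fun s hs => by
    rw [hν hs]
    exact le_iSup (fun n => μ n s) n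
  exact (hle B).trans_eq (hν hB)

/-! ### One step of the recursion -/

/-- The law of a tree whose first cut `C` has cost `c`, if the laws of the subtrees with the
remaining budget `t` are given by `F`. -/
noncomputable def nodeLaw (F : Set (Space d) → ℝ → Measure (CutTree d)) (D : Set (Space d))
    (c t : ℝ) (C : Cut d) : Measure (CutTree d) :=
  ((F (leftPart D C) t).prod (F (rightPart D C) t)).map fun u => BinTree.node (c, C) u.1 u.2

open Classical in
/-- One step of the procedure that cuts convex hulls, if the laws of the subtrees are given by
`F`. -/
noncomputable def step (F : Set (Space d) → ℝ → Measure (CutTree d)) (D : Set (Space d))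
    (τ : ℝ) : Measure (CutTree d) :=
  if totalPerimeter (convexHull ℝ D) = 0 then Measure.dirac .leaf
  else (expMeasure (totalPerimeter (convexHull ℝ D)).toReal).bind fun c =>
    if c < τ then (cutLaw (convexHull ℝ D)).bind fun C => nodeLaw F D c (τ - c) C
    else Measure.dirac .leaf

/-- A family of laws of trees of mass at most one, indexed by domain and budget, that is measurable
along closed families of domains. -/
structure IsRegular (F : Set (Space d) → ℝ → Measure (CutTree d)) : Prop where
  measurable : ∀ (X : Type) [TopologicalSpace X] [SecondCountableTopology X] [MeasurableSpace X]
    [BorelSpace X] (D : X → Set (Space d)), IsClosedFamily D → (∀ x, Admissible (D x)) →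
    Measurable fun z : X × ℝ => F (D z.1) z.2
  le_one : ∀ D, Admissible D → ∀ τ, F D τ Set.univ ≤ 1

section Step

variable {F F' : Set (Space d) → ℝ → Measure (CutTree d)} {D : Set (Space d)}

lemma IsRegular.isFiniteMeasure (hF : IsRegular F) (hD : Admissible D) (τ : ℝ) :
    IsFiniteMeasure (F D τ) :=
  ⟨(hF.le_one D hD τ).trans_lt ENNReal.one_lt_top⟩

lemma measurable_cutTree_node (c : ℝ) (C : Cut d) :
    Measurable fun u : CutTree d × CutTree d => BinTree.node (c, C) u.1 u.2 :=
  BinTree.measurable_node.comp (f := fun u : CutTree d × CutTree d => ((c, C), u.1, u.2))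
    (by fun_prop)

lemma nodeLaw_apply (F : Set (Space d) → ℝ → Measure (CutTree d)) (D : Set (Space d))
    (c t : ℝ) (C : Cut d) {B : Set (CutTree d)} (hB : MeasurableSet B) :
    nodeLaw F D c t C B = ((F (leftPart D C) t).prod (F (rightPart D C) t))
      ((fun u => BinTree.node (c, C) u.1 u.2) ⁻¹' B) :=
  Measure.map_apply (measurable_cutTree_node c C) hB

lemma nodeLaw_univ (hF : IsRegular F) (hD : Admissible D) (c t : ℝ) (C : Cut d) :
    nodeLaw F D c t C Set.univ = F (leftPart D C) t Set.univ * F (rightPart D C) t Set.univ := by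
  have := hF.isFiniteMeasure (hD.rightPart C) t
  rw [nodeLaw_apply _ _ _ _ _ .univ, Set.preimage_univ, ← Set.univ_prod_univ,
    Measure.prod_prod]

lemma nodeLaw_univ_le_one (hF : IsRegular F) (hD : Admissible D) (c t : ℝ) (C : Cut d) :
    nodeLaw F D c t C Set.univ ≤ 1 := by
  rw [nodeLaw_univ hF hD]
  exact mul_le_one' (hF.le_one _ (hD.leftPart C) t) (hF.le_one _ (hD.rightPart C) t)

lemma nodeLaw_mono (hF' : IsRegular F') (h : ∀ D, Admissible D → ∀ τ, F D τ ≤ F' D τ)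
    (hD : Admissible D) (c t : ℝ) (C : Cut d) : nodeLaw F D c t C ≤ nodeLaw F' D c t C := by
  have := hF'.isFiniteMeasure (hD.rightPart C) t
  exact Measure.map_mono (Measure.prod_mono (h _ (hD.leftPart C) t) (h _ (hD.rightPart C) t))
    (measurable_cutTree_node c C)

lemma one_le_nodeLaw_univ_add (hF : IsRegular F) (hD : Admissible D) (c : ℝ) {t : ℝ} {C : Cut d}
    {ε : ENNReal} (hl : 1 ≤ F (leftPart D C) t Set.univ + ε)
    (hr : 1 ≤ F (rightPart D C) t Set.univ + ε) :
    1 ≤ nodeLaw F D c t C Set.univ + 2 * ε := by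
  rw [nodeLaw_univ hF hD]
  have hr_le := hF.le_one _ (hD.rightPart C) t
  set p := F (leftPart D C) t Set.univ
  set q := F (rightPart D C) t Set.univ
  calc 1 ≤ q + ε := hr
    _ = 1 * q + ε := by rw [one_mul]
    _ ≤ (p + ε) * q + ε := by gcongr
    _ = p * q + ε * q + ε := by ring
    _ ≤ p * q + ε * 1 + ε := by gcongr
    _ = p * q + 2 * ε := by ring

lemma IsRegular.measurable_nodeLaw (hF : IsRegular F) (X : Type) [TopologicalSpace X]
    [SecondCountableTopology X] [MeasurableSpace X] [BorelSpace X] {D : X → Set (Space d)}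
    (hD : IsClosedFamily D) (hA : ∀ x, Admissible (D x)) :
    Measurable fun w : X × ℝ × ℝ × Cut d => nodeLaw F (D w.1) w.2.1 w.2.2.1 w.2.2.2 := by
  let κl : Kernel (X × ℝ × ℝ × Cut d) (CutTree d) :=
    ⟨fun w => F (leftPart (D w.1) w.2.2.2) w.2.2.1,
      (hF.measurable (X × Cut d) _ ((hD.comp continuous_fst).leftPart continuous_snd)
        fun z => (hA z.1).leftPart z.2).comp
        (f := fun w : X × ℝ × ℝ × Cut d => ((w.1, w.2.2.2), w.2.2.1)) (by fun_prop)⟩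
  let κr : Kernel (X × ℝ × ℝ × Cut d) (CutTree d) :=
    ⟨fun w => F (rightPart (D w.1) w.2.2.2) w.2.2.1,
      (hF.measurable (X × Cut d) _ ((hD.comp continuous_fst).rightPart continuous_snd)
        fun z => (hA z.1).rightPart z.2).comp
        (f := fun w : X × ℝ × ℝ × Cut d => ((w.1, w.2.2.2), w.2.2.1)) (by fun_prop)⟩
  have : IsFiniteKernel κl :=
    ⟨1, ENNReal.one_lt_top, fun w => hF.le_one _ ((hA w.1).leftPart w.2.2.2) w.2.2.1⟩
  have : IsFiniteKernel κr :=
    ⟨1, ENNReal.one_lt_top, fun w => hF.le_one _ ((hA w.1).rightPart w.2.2.2) w.2.2.1⟩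
  refine Measure.measurable_of_measurable_coe _ fun B hB => ?_
  have hS : MeasurableSet {z : (X × ℝ × ℝ × Cut d) × CutTree d × CutTree d |
      BinTree.node (z.1.2.1, z.1.2.2.2) z.2.1 z.2.2 ∈ B} :=
    BinTree.measurable_node.comp (f := fun z : (X × ℝ × ℝ × Cut d) × CutTree d × CutTree d =>
      ((z.1.2.1, z.1.2.2.2), z.2.1, z.2.2)) (by fun_prop) hB
  convert Kernel.measurable_kernel_prodMk_left (κ := κl ×ₖ κr) hS using 2 with w
  rw [nodeLaw_apply _ _ _ _ _ hB, Kernel.prod_apply]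
  rfl

lemma IsRegular.measurable_setLIntegral_nodeLaw (hF : IsRegular F) (X : Type) [TopologicalSpace X]
    [SecondCountableTopology X] [MeasurableSpace X] [BorelSpace X] {D : X → Set (Space d)}
    (hD : IsClosedFamily D) (hA : ∀ x, Admissible (D x)) {B : Set (CutTree d)}
    (hB : MeasurableSet B) :
    Measurable fun w : X × ℝ × ℝ =>
      ∫⁻ C in cutsMeeting (D w.1), nodeLaw F (D w.1) w.2.1 w.2.2 C B ∂cutMeasure d := by
  simp_rw [← lintegral_indicator (measurableSet_cutsMeeting (hA _).isCompact)]
  refine Measurable.lintegral_prod_right' (f := fun v : (X × ℝ × ℝ) × Cut d =>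
    (cutsMeeting (D v.1.1)).indicator (fun C => nodeLaw F (D v.1.1) v.1.2.1 v.1.2.2 C B) v.2) ?_
  exact Measurable.indicator
    (f := fun v : (X × ℝ × ℝ) × Cut d => nodeLaw F (D v.1.1) v.1.2.1 v.1.2.2 v.2 B)
    ((Measure.measurable_coe hB).comp ((hF.measurable_nodeLaw X hD hA).comp
      (f := fun v : (X × ℝ × ℝ) × Cut d => (v.1.1, v.1.2.1, v.1.2.2, v.2)) (by fun_prop)))
    ((by fun_prop : Measurable fun v : (X × ℝ × ℝ) × Cut d => (v.1.1, v.2))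
      hD.isClosed_cutsMeeting.measurableSet)

lemma bind_cutLaw_nodeLaw_apply (hF : IsRegular F) (hD : Admissible D) (c t : ℝ)
    {B : Set (CutTree d)} (hB : MeasurableSet B) :
    ((cutLaw (convexHull ℝ D)).bind fun C => nodeLaw F D c t C) B =
      (cutMeasure d (cutsMeeting D))⁻¹ *
        ∫⁻ C in cutsMeeting D, nodeLaw F D c t C B ∂cutMeasure d := by
  have hmeas : Measurable fun C => nodeLaw F D c t C :=
    (hF.measurable_nodeLaw Unit (isClosedFamily_const hD.isCompact) fun _ => hD).comp
      (f := fun C : Cut d => ((), c, t, C)) (by fun_prop)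
  rw [Measure.bind_apply hB hmeas.aemeasurable, hD.cutLaw_convexHull, ProbabilityTheory.cond,
    lintegral_smul_measure, smul_eq_mul]

lemma step_apply (hF : IsRegular F) (hD : Admissible D) (τ : ℝ) {B : Set (CutTree d)}
    (hB : MeasurableSet B) :
    step F D τ B = clockIntegral (rate D) τ
      (fun c => ∫⁻ C in cutsMeeting D, nodeLaw F D c (τ - c) C B ∂cutMeasure d)
      (B.indicator 1 BinTree.leaf) := by
  rw [step, hD.totalPerimeter_convexHull]
  split_ifs with h0
  · rw [Measure.restrict_eq_zero.2 h0, rate, h0]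
    simp [clockIntegral, Measure.dirac_apply' _ hB]
  set κ : ℝ → Measure (CutTree d) := fun c =>
    (cutLaw (convexHull ℝ D)).bind fun C => nodeLaw F D c (τ - c) C
  have hκ : Measurable κ := Measure.measurable_of_measurable_coe _ fun B hB => by
    simp_rw [κ, bind_cutLaw_nodeLaw_apply hF hD _ _ hB]
    exact ((hF.measurable_setLIntegral_nodeLaw Unit (isClosedFamily_const hD.isCompact)
      (fun _ => hD) hB).comp (f := fun c => ((), c, τ - c)) (by fun_prop)).const_mul _
  have hite (c : ℝ) : (if c < τ then κ c else Measure.dirac .leaf) B =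
      if c < τ then κ c B else B.indicator 1 BinTree.leaf := by
    split_ifs
    · rfl
    · exact Measure.dirac_apply' _ hB
  have hrate : 0 < (cutMeasure d (cutsMeeting D)).toReal :=
    ENNReal.toReal_pos h0 hD.cutMeasure_ne_top
  rw [Measure.bind_apply hB (Measurable.ite measurableSet_Iio hκ measurable_const).aemeasurable,
    lintegral_congr hite, lintegral_expMeasure_ite (G := fun c => κ c B) hrate τ
      ((Measure.measurable_coe hB).comp hκ), rate]
  congr 1
  ext c
  rw [bind_cutLaw_nodeLaw_apply hF hD _ _ hB,
    ENNReal.ofReal_toReal hD.cutMeasure_ne_top, ← mul_assoc,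
    ENNReal.mul_inv_cancel h0 hD.cutMeasure_ne_top, one_mul]

lemma clockIntegral_cutMeasure_one (hD : Admissible D) (τ : ℝ) :
    clockIntegral (rate D) τ (fun _ => ∫⁻ _ in cutsMeeting D, 1 ∂cutMeasure d) 1 = 1 := by
  rw [setLIntegral_one, ← ofReal_rate hD, clockIntegral_rate_one (rate_nonneg D)]

lemma step_univ_le_one (hF : IsRegular F) (hD : Admissible D) (τ : ℝ) :
    step F D τ Set.univ ≤ 1 := by
  rw [step_apply hF hD τ .univ, Set.indicator_univ, Pi.one_apply]
  refine le_trans ?_ (clockIntegral_cutMeasure_one hD τ).le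
  exact clockIntegral_mono (fun c _ _ => lintegral_mono fun C => nodeLaw_univ_le_one hF hD _ _ C) _

lemma IsRegular.step (hF : IsRegular F) : IsRegular (step F) where
  le_one _ hD τ := step_univ_le_one hF hD τ
  measurable X _ _ _ _ D hD hA := Measure.measurable_of_measurable_coe _ fun B hB => by
    have hrate : Measurable fun x => rate (D x) :=
      (measurable_measure_prodMk_left hD.isClosed_cutsMeeting.measurableSet).ennreal_toReal
    simp_rw [fun z : X × ℝ => step_apply hF (hA z.1) z.2 hB]
    exact measurable_clockIntegral (g := fun z c =>
        ∫⁻ C in cutsMeeting (D z.1), nodeLaw F (D z.1) c (z.2 - c) C B ∂cutMeasure d)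
      (hrate.comp measurable_fst) measurable_snd
      ((hF.measurable_setLIntegral_nodeLaw X hD hA hB).comp
        (f := fun w : (X × ℝ) × ℝ => (w.1.1, w.2, w.1.2 - w.2)) (by fun_prop)) _

lemma step_mono (hF : IsRegular F) (hF' : IsRegular F')
    (h : ∀ D, Admissible D → ∀ τ, F D τ ≤ F' D τ) (hD : Admissible D) (τ : ℝ) :
    step F D τ ≤ step F' D τ := by
  refine Measure.le_iff.2 fun B hB => ?_
  rw [step_apply hF hD τ hB, step_apply hF' hD τ hB]
  exact clockIntegral_mono (fun c _ _ => lintegral_mono fun C => nodeLaw_mono hF' h hD _ _ C B) _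

end Step

/-! ### The recursion stops -/

section Termination

variable {D : Set (Space d)}

/-- The law of the output of the procedure that cuts convex hulls, on the event that the recursion
has fewer than `n` levels. -/
noncomputable abbrev hullCutLawUpTo (n : ℕ) (D : Set (Space d)) (τ : ℝ) : Measure (CutTree d) :=
  treeLawUpTo (fun A => convexHull ℝ A) n D τ

lemma hullCutLawUpTo_succ (n : ℕ) :
    (hullCutLawUpTo (n + 1) : Set (Space d) → ℝ → Measure (CutTree d)) =
      step (hullCutLawUpTo n) := rfl

lemma isRegular_zero : IsRegular fun (_ : Set (Space d)) (_ : ℝ) => (0 : Measure (CutTree d)) where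
  measurable _ _ _ _ _ _ _ _ := measurable_const
  le_one _ _ _ := zero_le_one

lemma isRegular_hullCutLawUpTo (n : ℕ) : IsRegular (hullCutLawUpTo (d := d) n) := by
  induction n with
  | zero => exact isRegular_zero
  | succ n ih => exact ih.step

lemma hullCutLawUpTo_le_succ (n : ℕ) (hD : Admissible D) (τ : ℝ) :
    hullCutLawUpTo n D τ ≤ hullCutLawUpTo (n + 1) D τ := by
  induction n generalizing D τ with
  | zero => exact Measure.zero_le _
  | succ n ih =>
    exact step_mono (isRegular_hullCutLawUpTo n) (isRegular_hullCutLawUpTo (n + 1))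
      (fun D hD τ => ih hD τ) hD τ

lemma hullCutLaw_apply (hD : Admissible D) (τ : ℝ) {B : Set (CutTree d)} (hB : MeasurableSet B) :
    hullCutLaw D τ B = ⨆ n, hullCutLawUpTo n D τ B :=
  iSup_measure_apply (monotone_nat_of_le_succ fun n => hullCutLawUpTo_le_succ n hD τ) hB

lemma hullCutLawUpTo_le (n : ℕ) (D : Set (Space d)) (τ : ℝ) :
    hullCutLawUpTo n D τ ≤ hullCutLaw D τ :=
  le_iSup (fun n => hullCutLawUpTo n D τ) n

lemma isRegular_hullCutLaw : IsRegular (hullCutLaw (d := d)) where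
  le_one D hD τ := by
    rw [hullCutLaw_apply hD τ .univ]
    exact iSup_le fun n => (isRegular_hullCutLawUpTo n).le_one D hD τ
  measurable X _ _ _ _ D hD hA := Measure.measurable_of_measurable_coe _ fun B hB => by
    simp_rw [fun z : X × ℝ => hullCutLaw_apply (hA z.1) z.2 hB]
    exact .iSup fun n => (Measure.measurable_coe hB).comp
      ((isRegular_hullCutLawUpTo n).measurable X D hD hA)

/-- The exponent `4 * L` makes the error halve at each step: each of the two subtrees contributes
one error term, and integrating `exp (4 * L * (τ - c))` gains a factor `1 / (4 * L)`. -/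
lemma setLIntegral_exp_mul_error_le {r L A τ : ℝ} (hr : 0 ≤ r) (hrL : r ≤ L) (hA : 0 ≤ A)
    (hτ : 0 ≤ τ) :
    ∫⁻ c in Set.Ico 0 τ, ENNReal.ofReal (Real.exp (-(r * c))) *
        (2 * ENNReal.ofReal (A * Real.exp (4 * L * (τ - c))) * ENNReal.ofReal r) ≤
      ENNReal.ofReal (A / 2 * Real.exp (4 * L * τ)) := by
  have hL : 0 ≤ 4 * L := by linarith
  have hpoint : ∀ c, 0 ≤ c → Real.exp (-(r * c)) * (2 * (A * Real.exp (4 * L * (τ - c))) * r) ≤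
      A / 2 * Real.exp (4 * L * τ) * (4 * L * Real.exp (-(4 * L * c))) := fun c hc =>
    calc _ ≤ 1 * (2 * (A * Real.exp (4 * L * (τ - c))) * L) := by
          gcongr
          exact Real.exp_le_one_iff.2 (neg_nonpos.2 (mul_nonneg hr hc))
      _ = _ := by rw [mul_sub, sub_eq_add_neg, Real.exp_add]; ring
  calc _ ≤ ∫⁻ c in Set.Ico 0 τ, ENNReal.ofReal (A / 2 * Real.exp (4 * L * τ)) *
        ENNReal.ofReal (4 * L * Real.exp (-(4 * L * c))) := by
        refine setLIntegral_mono (by fun_prop) fun c hc => ?_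
        rw [← ENNReal.ofReal_ofNat 2, ← ENNReal.ofReal_mul (by norm_num),
          ← ENNReal.ofReal_mul (by positivity), ← ENNReal.ofReal_mul (Real.exp_pos _).le,
          ← ENNReal.ofReal_mul (by positivity)]
        exact ENNReal.ofReal_le_ofReal (hpoint c hc.1)
    _ ≤ ENNReal.ofReal (A / 2 * Real.exp (4 * L * τ)) * 1 := by
        rw [lintegral_const_mul _ (by fun_prop), ← setLIntegral_exp_add hL hτ]
        gcongr
        exact le_self_add
    _ = _ := mul_one _

lemma one_le_hullCutLawUpTo_univ_add (n : ℕ) {L : ℝ} (hD : Admissible D) (hDL : rate D ≤ L) {τ : ℝ}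
    (hτ : 0 ≤ τ) :
    1 ≤ hullCutLawUpTo n D τ Set.univ +
      ENNReal.ofReal ((1 / 2) ^ n * Real.exp (4 * L * τ)) := by
  have hL := (rate_nonneg D).trans hDL
  induction n generalizing D τ with
  | zero =>
    refine le_add_left ?_
    rw [pow_zero, one_mul, ENNReal.one_le_ofReal]
    exact Real.one_le_exp (by positivity)
  | succ n ih =>
    set ε : ℝ → ENNReal := fun t => ENNReal.ofReal ((1 / 2) ^ n * Real.exp (4 * L * t))
    have hF := isRegular_hullCutLawUpTo (d := d) n
    have hpart {E : Set (Space d)} (hE : E ⊆ D) : rate E ≤ L :=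
      (rate_mono hD (hE.trans (subset_convexHull ℝ D))).trans hDL
    have hnode (c : ℝ) (hc : c < τ) (C : Cut d) :
        1 ≤ nodeLaw (hullCutLawUpTo n) D c (τ - c) C Set.univ + 2 * ε (τ - c) :=
      one_le_nodeLaw_univ_add hF hD c
        (ih (hD.leftPart C) (hpart (Set.sep_subset _ _)) (sub_nonneg.2 hc.le))
        (ih (hD.rightPart C) (hpart (Set.sep_subset _ _)) (sub_nonneg.2 hc.le))
    have herror := setLIntegral_exp_mul_error_le (rate_nonneg D) hDL
      (by positivity : (0 : ℝ) ≤ (1 / 2) ^ n) hτ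
    calc (1 : ENNReal)
        = clockIntegral (rate D) τ (fun _ => ∫⁻ _ in cutsMeeting D, 1 ∂cutMeasure d) 1 :=
          (clockIntegral_cutMeasure_one hD τ).symm
      _ ≤ clockIntegral (rate D) τ (fun c =>
            (∫⁻ C in cutsMeeting D, nodeLaw (hullCutLawUpTo n) D c (τ - c) C Set.univ
              ∂cutMeasure d) + 2 * ε (τ - c) * ENNReal.ofReal (rate D)) 1 :=
          clockIntegral_mono (fun c _ hc => by
            rw [ofReal_rate hD, ← setLIntegral_const, ← lintegral_add_right _ measurable_const]
            exact lintegral_mono fun C => hnode c hc C) _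
      _ ≤ _ := by
          rw [clockIntegral_add (by fun_prop), hullCutLawUpTo_succ, step_apply hF hD τ .univ,
            Set.indicator_univ, Pi.one_apply, pow_succ, mul_one_div]
          exact add_le_add_right herror _

lemma isProbabilityMeasure_hullCutLaw (hD : Admissible D) (τ : ℝ) :
    IsProbabilityMeasure (hullCutLaw D τ) := by
  refine ⟨le_antisymm (isRegular_hullCutLaw.le_one D hD τ) ?_⟩
  rcases lt_or_ge τ 0 with hτ | hτ
  · refine le_trans ?_ (hullCutLawUpTo_le 1 D τ _)
    rw [hullCutLawUpTo_succ, step_apply (isRegular_hullCutLawUpTo 0) hD τ .univ,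
      clockIntegral_of_nonpos _ hτ.le, Set.indicator_univ, Pi.one_apply]
  · have hlim : Filter.Tendsto (fun n : ℕ => hullCutLaw D τ Set.univ +
        ENNReal.ofReal ((1 / 2) ^ n * Real.exp (4 * rate D * τ))) Filter.atTop
        (nhds (hullCutLaw D τ Set.univ + ENNReal.ofReal (0 * Real.exp (4 * rate D * τ)))) :=
      tendsto_const_nhds.add (ENNReal.tendsto_ofReal
        ((tendsto_pow_atTop_nhds_zero_of_lt_one (by norm_num) (by norm_num)).mul_const _))
    rw [zero_mul, ENNReal.ofReal_zero, add_zero] at hlim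
    exact ge_of_tendsto' hlim fun n => (one_le_hullCutLawUpTo_univ_add n hD le_rfl hτ).trans
      (add_le_add_left (hullCutLawUpTo_le n D τ _) _)

lemma step_hullCutLaw (hD : Admissible D) (τ : ℝ) : step hullCutLaw D τ = hullCutLaw D τ := by
  have := isProbabilityMeasure_hullCutLaw hD τ
  have hle : hullCutLaw D τ ≤ step hullCutLaw D τ :=
    iSup_le fun n => (hullCutLawUpTo_le_succ n hD τ).trans <|
      step_mono (isRegular_hullCutLawUpTo n) isRegular_hullCutLaw
        (fun D _ τ => hullCutLawUpTo_le n D τ) hD τ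
  have hone := step_univ_le_one isRegular_hullCutLaw hD τ
  have : IsFiniteMeasure (step hullCutLaw D τ) := ⟨hone.trans_lt ENNReal.one_lt_top⟩
  refine (Measure.eq_of_le_of_measure_univ_eq hle (le_antisymm (hle _) ?_)).symm
  rwa [measure_univ (μ := hullCutLaw D τ)]

end Termination

/-! ### The law of the restriction -/

section Restriction

variable {K D : Set (Space d)}

lemma leftPart_mono (h : D ⊆ K) (C : Cut d) : leftPart D C ⊆ leftPart K C :=
  fun _ hx => ⟨h hx.1, hx.2⟩

lemma rightPart_mono (h : D ⊆ K) (C : Cut d) : rightPart D C ⊆ rightPart K C :=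
  fun _ hx => ⟨h hx.1, hx.2⟩

lemma convex_rightPart (hK : Convex ℝ K) (C : Cut d) : Convex ℝ (rightPart K C) := by
  rw [rightPart_eq_leftPart_flip]
  exact convex_leftPart hK C.flip

lemma subset_leftPart_of_not_nonempty (hDK : D ⊆ K) {C : Cut d}
    (hr : ¬ (rightPart D C).Nonempty) : D ⊆ leftPart K C :=
  fun x hx => ⟨hDK hx, (not_le.1 fun h0 => hr ⟨x, hx, h0⟩).le⟩

lemma subset_rightPart_of_notMem_cutsMeeting (hDK : D ⊆ K) {C : Cut d} (hC : C ∉ cutsMeeting D)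
    (hr : (rightPart D C).Nonempty) : D ⊆ rightPart K C :=
  fun x hx => ⟨hDK hx, (not_le.1 fun h0 => hC ⟨⟨x, hx, h0⟩, hr⟩).le⟩

lemma measurable_restrict (hD : Admissible D) :
    Measurable fun t : CutTree d => restrictHull t D 0 :=
  measurable_restrictHull hD.isCompact 0

/-- The law `F K τ` of a tree on a convex block, restricted to a domain `D` of the block, is at most
`F' D τ`. For laws that are cut off at some depth only such an inequality can be expected, since
skipped cuts count for the depth of the tree but not for that of its restriction. -/
def RestrictsBelow (F F' : Set (Space d) → ℝ → Measure (CutTree d)) : Prop :=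
  ∀ ⦃K D : Set (Space d)⦄, Admissible K → Convex ℝ K → Admissible D → D ⊆ K → ∀ τ,
    (F K τ).map (fun t => restrictHull t D 0) ≤ F' D τ

variable {F F' : Set (Space d) → ℝ → Measure (CutTree d)}

lemma RestrictsBelow.nodeLaw_map_le_of_mem (h : RestrictsBelow F F') (hF : IsRegular F)
    (hF' : IsRegular F') (hK : Admissible K) (hKc : Convex ℝ K) (hD : Admissible D) (hDK : D ⊆ K)
    {C : Cut d} (hC : C ∈ cutsMeeting D) (c t : ℝ) :
    (nodeLaw F K c t C).map (fun t => restrictHull t D 0) ≤ nodeLaw F' D c t C := by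
  have := hF.isFiniteMeasure (hK.leftPart C) t
  have := hF.isFiniteMeasure (hK.rightPart C) t
  have := hF'.isFiniteMeasure (hD.rightPart C) t
  have hl := measurable_restrict (hD.leftPart C)
  have hr := measurable_restrict (hD.rightPart C)
  have hnode := measurable_cutTree_node c C
  have hcomp : (fun t => restrictHull t D 0) ∘ (fun u : CutTree d × CutTree d =>
        BinTree.node (c, C) u.1 u.2) =
      (fun u => BinTree.node (c, C) u.1 u.2) ∘ Prod.map (fun t => restrictHull t (leftPart D C) 0)
        (fun t => restrictHull t (rightPart D C) 0) := by
    ext1 u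
    simp only [Function.comp_apply, Prod.map, restrictHull_node, if_pos hC, zero_add]
  rw [nodeLaw, Measure.map_map (measurable_restrict hD) hnode, hcomp,
    ← Measure.map_map hnode (hl.prodMap hr), ← Measure.map_prod_map _ _ hl hr]
  exact Measure.map_mono (Measure.prod_mono
    (h (hK.leftPart C) (convex_leftPart hKc C) (hD.leftPart C) (leftPart_mono hDK C) t)
    (h (hK.rightPart C) (convex_rightPart hKc C) (hD.rightPart C) (rightPart_mono hDK C) t)) hnode

lemma map_node_map_restrict_le (hD : Admissible D) {e : ℝ × Cut d}
    {side : CutTree d × CutTree d → CutTree d} (hside : Measurable side)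
    (hskip : ∀ u, restrictHull (.node e u.1 u.2) D 0 = shift e.1 (restrictHull (side u) D 0))
    {ν : Measure (CutTree d × CutTree d)} {μ μ' : Measure (CutTree d)} (hν : ν.map side ≤ μ)
    (hμ : μ.map (fun t => restrictHull t D 0) ≤ μ') :
    (ν.map fun u => BinTree.node e u.1 u.2).map (fun t => restrictHull t D 0) ≤
      μ'.map (shift e.1) := by
  have hres := measurable_restrict hD
  have hshift := measurable_shift (d := d) e.1
  have hcomp : (fun t => restrictHull t D 0) ∘ (fun u : CutTree d × CutTree d =>
      BinTree.node e u.1 u.2) = shift e.1 ∘ (fun t => restrictHull t D 0) ∘ side := funext hskip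
  rw [Measure.map_map hres (measurable_cutTree_node e.1 e.2), hcomp,
    ← Measure.map_map hshift (hres.comp hside), ← Measure.map_map hres hside]
  exact Measure.map_mono ((Measure.map_mono hν hres).trans hμ) hshift

lemma smul_measure_le_self {Ω : Type*} [MeasurableSpace Ω] {a : ENNReal} (ha : a ≤ 1)
    (μ : Measure Ω) : a • μ ≤ μ :=
  Measure.le_iff'.2 fun _ => mul_le_of_le_one_left' ha

lemma RestrictsBelow.nodeLaw_map_le_of_notMem (h : RestrictsBelow F F') (hF : IsRegular F)
    (hK : Admissible K) (hKc : Convex ℝ K) (hD : Admissible D) (hDK : D ⊆ K)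
    {C : Cut d} (hC : C ∉ cutsMeeting D) (c t : ℝ) :
    (nodeLaw F K c t C).map (fun t => restrictHull t D 0) ≤ (F' D t).map (shift c) := by
  have := hF.isFiniteMeasure (hK.leftPart C) t
  have := hF.isFiniteMeasure (hK.rightPart C) t
  by_cases hr : (rightPart D C).Nonempty
  · refine map_node_map_restrict_le hD (e := (c, C)) measurable_snd (fun u => ?_) ?_
      (h (hK.rightPart C) (convex_rightPart hKc C) hD
        (subset_rightPart_of_notMem_cutsMeeting hDK hC hr) t)
    · rw [restrictHull_node, if_neg hC, if_pos hr, zero_add, restrictHull_eq_shift]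
    · rw [Measure.map_snd_prod]
      exact smul_measure_le_self (hF.le_one _ (hK.leftPart C) t) _
  · refine map_node_map_restrict_le hD (e := (c, C)) measurable_fst (fun u => ?_) ?_
      (h (hK.leftPart C) (convex_leftPart hKc C) hD
        (subset_leftPart_of_not_nonempty hDK hr) t)
    · rw [restrictHull_node, if_neg hC, if_neg hr, zero_add, restrictHull_eq_shift]
    · rw [Measure.map_fst_prod]
      exact smul_measure_le_self (hF.le_one _ (hK.rightPart C) t) _

lemma cutMeasure_cutsMeeting_sdiff (hK : Admissible K) (hD : Admissible D)
    (hDK : D ⊆ convexHull ℝ K) :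
    cutMeasure d (cutsMeeting K \ cutsMeeting D) = ENNReal.ofReal (rate K - rate D) := by
  rw [measure_sdiff (cutsMeeting_mono hDK)
      (measurableSet_cutsMeeting hD.isCompact).nullMeasurableSet hD.cutMeasure_ne_top,
    ENNReal.ofReal_sub _ (rate_nonneg D), ofReal_rate hD, ofReal_rate hK]

lemma RestrictsBelow.setLIntegral_nodeLaw_le (h : RestrictsBelow F F') (hF : IsRegular F)
    (hF' : IsRegular F') (hK : Admissible K) (hKc : Convex ℝ K) (hD : Admissible D) (hDK : D ⊆ K)
    (c t : ℝ) {B : Set (CutTree d)} (hB : MeasurableSet B) :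
    ∫⁻ C in cutsMeeting K, nodeLaw F K c t C ((fun t => restrictHull t D 0) ⁻¹' B)
        ∂cutMeasure d ≤
      (∫⁻ C in cutsMeeting D, nodeLaw F' D c t C B ∂cutMeasure d) +
        ENNReal.ofReal (rate K - rate D) * F' D t (shift c ⁻¹' B) := by
  have hDK' : D ⊆ convexHull ℝ K := hDK.trans (subset_convexHull ℝ K)
  have hmK := measurableSet_cutsMeeting hK.isCompact
  have hmD := measurableSet_cutsMeeting hD.isCompact
  simp_rw [← Measure.map_apply (measurable_restrict hD) hB]
  rw [← lintegral_inter_add_sdiff _ _ hmD, Set.inter_eq_right.2 (cutsMeeting_mono hDK'),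
    ← cutMeasure_cutsMeeting_sdiff hK hD hDK', mul_comm, ← setLIntegral_const,
    ← Measure.map_apply (measurable_shift c) hB]
  exact add_le_add
    (setLIntegral_mono' hmD fun C hC => h.nodeLaw_map_le_of_mem hF hF' hK hKc hD hDK hC c t B)
    (setLIntegral_mono' (hmK.diff hmD) fun C hC =>
      h.nodeLaw_map_le_of_notMem hF hK hKc hD hDK hC.2 c t B)

lemma nodeLaw_preimage_shift (F : Set (Space d) → ℝ → Measure (CutTree d)) (D : Set (Space d))
    (a c t : ℝ) (C : Cut d) {B : Set (CutTree d)} (hB : MeasurableSet B) :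
    nodeLaw F D c t C (shift a ⁻¹' B) = nodeLaw F D (a + c) t C B := by
  rw [nodeLaw_apply _ _ _ _ _ (measurable_shift a hB), nodeLaw_apply _ _ _ _ _ hB]
  rfl

lemma hullCutLaw_preimage_shift (hD : Admissible D) (τ c : ℝ) {B : Set (CutTree d)}
    (hB : MeasurableSet B) :
    hullCutLaw D (τ - c) (shift c ⁻¹' B) = clockIntegral (rate D) (τ - c)
      (fun b => ∫⁻ C in cutsMeeting D, nodeLaw hullCutLaw D (c + b) (τ - (c + b)) C B
        ∂cutMeasure d) (B.indicator 1 BinTree.leaf) := by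
  rw [← step_hullCutLaw hD, step_apply isRegular_hullCutLaw hD _ (measurable_shift c hB)]
  simp_rw [nodeLaw_preimage_shift _ _ _ _ _ _ hB, sub_sub]
  rfl

/-- By memorylessness a skipped cut restarts the clock of `D`; thinning the clock of rate `rate K`
by the probability that a cut meets `D` leaves a clock of rate `rate D`. -/
lemma RestrictsBelow.step (h : RestrictsBelow F hullCutLaw) (hF : IsRegular F) :
    RestrictsBelow (step F) hullCutLaw := by
  intro K D hK hKc hD hDK τ
  refine Measure.le_iff.2 fun B hB => ?_
  have hT := isRegular_hullCutLaw (d := d)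
  have hres := measurable_restrict hD
  set g : ℝ → ENNReal := fun c =>
    ∫⁻ C in cutsMeeting D, nodeLaw hullCutLaw D c (τ - c) C B ∂cutMeasure d
  have hg : Measurable g :=
    (hT.measurable_setLIntegral_nodeLaw Unit (isClosedFamily_const hD.isCompact)
      (fun _ => hD) hB).comp (f := fun c => ((), c, τ - c)) (by fun_prop)
  calc (BSP.step F K τ).map (fun t => restrictHull t D 0) B
      = clockIntegral (rate K) τ (fun c => ∫⁻ C in cutsMeeting K,
          nodeLaw F K c (τ - c) C ((fun t => restrictHull t D 0) ⁻¹' B) ∂cutMeasure d)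
          (B.indicator 1 BinTree.leaf) := by
        rw [Measure.map_apply hres hB, step_apply hF hK τ (hres hB)]
        rfl
    _ ≤ clockIntegral (rate K) τ (fun c => g c + ENNReal.ofReal (rate K - rate D) *
          hullCutLaw D (τ - c) (shift c ⁻¹' B)) (B.indicator 1 BinTree.leaf) :=
        clockIntegral_mono (fun c _ _ =>
          h.setLIntegral_nodeLaw_le hF hT hK hKc hD hDK c (τ - c) hB) _
    _ = clockIntegral (rate D) τ g (B.indicator 1 BinTree.leaf) := by
        simp_rw [hullCutLaw_preimage_shift hD τ _ hB]
        exact exponential_thinning (rate_mono hK (hDK.trans (subset_convexHull ℝ K))) τ hg _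
    _ = hullCutLaw D τ B := by rw [← step_apply hT hD τ hB, step_hullCutLaw hD]

lemma restrictsBelow_hullCutLawUpTo (n : ℕ) :
    RestrictsBelow (hullCutLawUpTo (d := d) n) hullCutLaw := by
  induction n with
  | zero => exact fun K D _ _ _ _ τ => Measure.map_zero _ |>.trans_le (Measure.zero_le _)
  | succ n ih => exact ih.step (isRegular_hullCutLawUpTo n)

theorem hullCutLaw_map_restrictHull (hK : Admissible K) (hKc : Convex ℝ K) (hD : Admissible D)
    (hDK : D ⊆ K) (τ : ℝ) :
    (hullCutLaw K τ).map (fun t => restrictHull t D 0) = hullCutLaw D τ := by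
  have hres := measurable_restrict hD
  have := isProbabilityMeasure_hullCutLaw hK τ
  have := isProbabilityMeasure_hullCutLaw hD τ
  have := Measure.isProbabilityMeasure_map (μ := hullCutLaw K τ) hres.aemeasurable
  refine Measure.eq_of_le_of_isProbabilityMeasure (Measure.le_iff.2 fun B hB => ?_)
  rw [Measure.map_apply hres hB, hullCutLaw_apply hK τ (hres hB)]
  refine iSup_le fun n => ?_
  rw [← Measure.map_apply hres hB]
  exact restrictsBelow_hullCutLawUpTo n hK hKc hD hDK τ B

end Restriction

/-! ### Cutting blocks -/

section Block

variable {K : Set (Space d)}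

lemma treeLawUpTo_id (n : ℕ) (hK : Convex ℝ K) (τ : ℝ) :
    treeLawUpTo id n K τ = hullCutLawUpTo n K τ := by
  induction n generalizing K τ with
  | zero => rfl
  | succ n ih =>
    simp only [treeLawUpTo, id, hK.convexHull_eq, ih (convex_leftPart hK _),
      ih (convex_rightPart hK _)]

lemma blockCutLaw_eq_hullCutLaw (hK : Convex ℝ K) (τ : ℝ) : blockCutLaw K τ = hullCutLaw K τ := by
  simp only [blockCutLaw, hullCutLaw, treeLaw, treeLawUpTo_id _ hK]

lemma restrictFrom_id (t : CutTree d) (hK : Convex ℝ K) (a : ℝ) :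
    restrictFrom id t K a = restrictHull t K a := by
  unfold restrictHull
  induction t generalizing K a with
  | leaf => rfl
  | node e l r ihl ihr =>
    simp only [restrictFrom, id, ihl hK, ihr hK, ihl (convex_leftPart hK _),
      ihr (convex_rightPart hK _)]
    have hmeets : (hyperplane (convexHull ℝ K) e.2).Nonempty ↔ (hyperplane K e.2).Nonempty := by
      rw [hK.convexHull_eq]
    by_cases h : (hyperplane K e.2).Nonempty
    · rw [if_pos h, if_pos (hmeets.2 h)]
    · rw [if_neg h, if_neg (mt hmeets.1 h)]

theorem blockCutLaw_map_restrictToHulls (hK : IsPolytope K) {S : Set (Space d)} (hS : S.Finite)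
    (hSK : S ⊆ K) (τ : ℝ) :
    (blockCutLaw K τ).map (restrictToHulls S) = hullCutLaw S τ := by
  rw [blockCutLaw_eq_hullCutLaw hK.convex]
  exact hullCutLaw_map_restrictHull (Or.inr hK) hK.convex (Or.inl hS) hSK τ

theorem blockCutLaw_map_restrictToBlock (hK : IsPolytope K) {K' : Set (Space d)}
    (hK' : IsPolytope K') (hK'K : K' ⊆ K) (τ : ℝ) :
    (blockCutLaw K τ).map (restrictToBlock K') = blockCutLaw K' τ := by
  have hrestrict : restrictToBlock K' = fun t => restrictHull t K' 0 :=
    funext fun t => restrictFrom_id t hK'.convex 0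
  rw [blockCutLaw_eq_hullCutLaw hK.convex, blockCutLaw_eq_hullCutLaw hK'.convex, hrestrict]
  exact hullCutLaw_map_restrictHull (Or.inr hK) hK.convex (Or.inr hK') hK'K τ

theorem isProbabilityMeasure_blockCutLaw (hK : IsPolytope K) (τ : ℝ) :
    IsProbabilityMeasure (blockCutLaw K τ) := by
  rw [blockCutLaw_eq_hullCutLaw hK.convex]
  exact isProbabilityMeasure_hullCutLaw (Or.inr hK) τ

theorem isProbabilityMeasure_cutLaw (hK : IsPolytope K) (h0 : totalPerimeter K ≠ 0) :
    IsProbabilityMeasure (cutLaw K) := by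
  have htop := totalPerimeter_ne_top hK
  rw [totalPerimeter_eq hK] at h0 htop
  rw [cutLaw_eq_cond hK]
  exact cond_isProbabilityMeasure_of_finite h0 htop

theorem cutLaw_eq_cond_cutLaw (hK : IsPolytope K) {K' : Set (Space d)} (hK' : IsPolytope K')
    (hK'K : K' ⊆ K) :
    cutLaw K' = cond (cutLaw K) {C | (hyperplane K' C).Nonempty} := by
  simp only [hyperplane_nonempty_iff hK'.convex, Set.ofPred_mem_eq]
  rw [cutLaw_eq_cond hK, cutLaw_eq_cond hK',
    cond_cond_eq_cond_inter' (measurableSet_cutsMeeting hK.isCompact)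
      (measurableSet_cutsMeeting hK'.isCompact)
      (totalPerimeter_eq hK ▸ totalPerimeter_ne_top hK),
    Set.inter_eq_right.2 (cutsMeeting_mono (hK'K.trans (subset_convexHull ℝ K)))]

end Block

end BSP

theorem corollary1 (d : ℕ) (F S : Finset (BSP.Space d))
    (hS : (S : Set (BSP.Space d)) ⊆ convexHull ℝ (F : Set (BSP.Space d))) :
    (BSP.totalPerimeter (convexHull ℝ (S : Set (BSP.Space d))) ≠ 0 →
      MeasureTheory.IsProbabilityMeasure
        (BSP.cutLaw (convexHull ℝ (S : Set (BSP.Space d)))) ∧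
      BSP.cutLaw (convexHull ℝ (S : Set (BSP.Space d))) =
        ProbabilityTheory.cond (BSP.cutLaw (convexHull ℝ (F : Set (BSP.Space d))))
          {C | (BSP.hyperplane (convexHull ℝ (S : Set (BSP.Space d))) C).Nonempty}) ∧
    ∀ τ : ℝ,
      MeasureTheory.IsProbabilityMeasure
        (BSP.blockCutLaw (convexHull ℝ (F : Set (BSP.Space d))) τ) ∧
      MeasureTheory.IsProbabilityMeasure (BSP.hullCutLaw (S : Set (BSP.Space d)) τ) ∧
      BSP.hullCutLaw (S : Set (BSP.Space d)) τ =
        (BSP.blockCutLaw (convexHull ℝ (F : Set (BSP.Space d))) τ).map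
          (BSP.restrictToHulls (S : Set (BSP.Space d))) ∧
      BSP.blockCutLaw (convexHull ℝ (S : Set (BSP.Space d))) τ =
        (BSP.blockCutLaw (convexHull ℝ (F : Set (BSP.Space d))) τ).map
          (BSP.restrictToBlock (convexHull ℝ (S : Set (BSP.Space d)))) := by
  have hF' : BSP.IsPolytope (convexHull ℝ (F : Set (BSP.Space d))) := ⟨F, rfl⟩
  have hS' : BSP.IsPolytope (convexHull ℝ (S : Set (BSP.Space d))) := ⟨S, rfl⟩
  have hSF := convexHull_min hS hF'.convex
  refine ⟨fun h0 => ⟨?_, ?_⟩, fun τ => ⟨?_, ?_, ?_, ?_⟩⟩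
  · exact BSP.isProbabilityMeasure_cutLaw hS' h0
  · exact BSP.cutLaw_eq_cond_cutLaw hF' hS' hSF
  · exact BSP.isProbabilityMeasure_blockCutLaw hF' τ
  · exact BSP.isProbabilityMeasure_hullCutLaw (.inl S.finite_toSet) τ
  · exact (BSP.blockCutLaw_map_restrictToHulls hF' S.finite_toSet hS τ).symm
  · exact (BSP.blockCutLaw_map_restrictToBlock hF' hS' hSF τ).symm
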